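/- Let $C$ be a finite set of candidates. A weak order on $C$ is a complete, transitive (hence reflexive) binary relation on $C$; write $a > b$ for strict preference and $a \sim b$ for a tie. A preference profile $V$ is a finite collection of weak orders on $C$, one for each voter. An axis is a total ordering $L$ of $C$. The profile $V$ is single-peaked with outside options with respect to $L$ if for every $v \in V$ the axis $L$ can be split, from left to right, into five segments $O_1, X, Y, Z, O_2$ ($O_1, X, Z, O_2$ possibly empty) such that $Y = \{p\}$, where $p$ is the unique most preferred candidate of $v$; $v$ is strictly increasing along $X$ (each candidate is strictly preferred to the one on its left) and strictly decreasing along $Z$ (each candidate is strictly preferred to the one on its right); $a > b$ in $v$ for all $a \in X \cup Y \cup Z$ and $b \in O_1 \cup O_2$; and $x \sim y$ in $v$ for all $x, y \in O_1 \cup O_2$. Theorem. Given a preference profile $V$ of weak orders, it can be decided in polynomial time whether there exists an axis $L$ such that $V$ is single-peaked with outside options with respect to $L$. That is, there is a deterministic Turing machine which, given any profile $V$, presented by the number of candidates in unary followed by the $0/1$ comparison matrix of each vote, halts after a number of steps bounded by a polynomial in the length of this presentation and outputs whether such an axis exists. -/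

import Mathlib

/-- A weak order on `C` (a vote with ties): a complete and transitive (hence reflexive) binary
relation; `v.rel a b` says that `a` is at least as good as `b` according to `v`. -/
structure WeakOrder (C : Type) where
  rel : C → C → Prop
  complete : ∀ a b, rel a b ∨ rel b a
  transitive : ∀ a b c, rel a b → rel b c → rel a c

/-- `a > b`: the voter strictly prefers `a` to `b`. -/
def WeakOrder.Prefers {C : Type} (v : WeakOrder C) (a b : C) : Prop :=
  v.rel a b ∧ ¬ v.rel b a

/-- `a ∼ b`: the voter is indifferent between `a` and `b`. -/
def WeakOrder.Tied {C : Type} (v : WeakOrder C) (a b : C) : Prop :=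
  v.rel a b ∧ v.rel b a

/-- An axis: a total ordering of the finitely many candidates, given as the list of all
candidates from left to right, each occurring exactly once. -/
structure Axis (C : Type) where
  order : List C
  nodup : order.Nodup
  complete : ∀ c, c ∈ order

/-- `v` is strictly increasing along the segment `S` (listed from left to right): each candidate
is strictly preferred to the candidate on its left. -/
def WeakOrder.StrictlyIncreasingAlong {C : Type} (v : WeakOrder C) (S : List C) : Prop :=
  S.IsChain (fun a b => v.Prefers b a)

/-- `v` is strictly decreasing along the segment `S` (listed from left to right): each candidate
is strictly preferred to the candidate on its right. -/
def WeakOrder.StrictlyDecreasingAlong {C : Type} (v : WeakOrder C) (S : List C) : Prop :=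
  S.IsChain (fun a b => v.Prefers a b)

/-- The condition on a single vote `v`: the axis splits, from left to right, into segments
`O₁`, `X`, `Y = [p]`, `Z`, `O₂`, all but `Y` possibly empty, where `p` is the unique most
preferred candidate of `v`. -/
def WeakOrder.IsSinglePeakedWithOutsideOptions {C : Type} (v : WeakOrder C) (L : Axis C) : Prop :=
  ∃ (O₁ X : List C) (p : C) (Z O₂ : List C),
    L.order = O₁ ++ X ++ [p] ++ Z ++ O₂ ∧
    (∀ c, c ≠ p → v.Prefers p c) ∧
    v.StrictlyIncreasingAlong X ∧
    v.StrictlyDecreasingAlong Z ∧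
    (∀ a ∈ X ++ [p] ++ Z, ∀ b ∈ O₁ ++ O₂, v.Prefers a b) ∧
    (∀ x ∈ O₁ ++ O₂, ∀ y ∈ O₁ ++ O₂, v.Tied x y)

/-- A preference profile of weak orders over a finite set of candidates, which are numbered
`0, …, numCandidates - 1`; the list `votes` holds one weak order for each voter. -/
structure Profile where
  numCandidates : ℕ
  votes : List (WeakOrder (Fin numCandidates))

/-- The profile is single-peaked with outside options with respect to the axis `L`. -/
def Profile.IsSinglePeakedWithOutsideOptions (V : Profile) (L : Axis (Fin V.numCandidates)) :
    Prop :=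
  ∀ v ∈ V.votes, v.IsSinglePeakedWithOutsideOptions L

open Classical in
/-- A vote over `m` candidates as a string over the alphabet `Γ'` (bits, brackets, comma): between
brackets, for each candidate `a`, the bits `v.rel a 0, …, v.rel a (m - 1)` followed by a comma. -/
noncomputable def WeakOrder.encode {m : ℕ} (v : WeakOrder (Fin m)) : List Computability.Γ' :=
  [.bra] ++
    (List.ofFn fun a => (List.ofFn fun b => Computability.Γ'.bit (decide (v.rel a b))) ++
      [.comma]).flatten ++
    [.ket]

/-- A profile as a string: the number of candidates in unary, a comma, and then the votes. -/
noncomputable def Profile.encode (V : Profile) : List Computability.Γ' :=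
  List.replicate V.numCandidates (.bit true) ++ [.comma] ++ V.votes.flatMap WeakOrder.encode

theorem WeakOrder.length_encode {m : ℕ} (v : WeakOrder (Fin m)) :
    v.encode.length = m * (m + 1) + 2 := by
  simp [WeakOrder.encode, List.length_flatten, List.map_ofFn, Function.comp_def]

theorem WeakOrder.encode_injective {m : ℕ} :
    Function.Injective (WeakOrder.encode (m := m)) := by
  intro v w h
  simp only [WeakOrder.encode, List.append_cancel_right_eq, List.append_cancel_left_eq] at h
  have h2 := List.eq_iff_flatten_eq.2 ⟨h, by simp [List.map_ofFn, Function.comp_def]⟩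
  have h3 := List.ofFn_injective h2
  have h4 : ∀ a b, v.rel a b ↔ w.rel a b := by
    intro a b
    have h5 := congrFun h3 a
    simp only [List.append_cancel_right_eq] at h5
    have h6 := congrFun (List.ofFn_injective h5) b
    simpa using h6
  cases v; cases w
  simp only [WeakOrder.mk.injEq]
  ext a b
  exact h4 a b

/-- Distinct profiles are represented by distinct strings. -/
theorem Profile.encode_injective : Function.Injective Profile.encode := by
  have key : ∀ (k l : ℕ) (s t : List Computability.Γ'),
      List.replicate k (Computability.Γ'.bit true) ++ [.comma] ++ s =
        List.replicate l (.bit true) ++ [.comma] ++ t → k = l ∧ s = t := by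
    intro k
    induction k with
    | zero => intro l s t h; cases l <;> simp_all [List.replicate_succ]
    | succ k ih =>
      intro l s t h
      cases l with
      | zero => simp [List.replicate_succ] at h
      | succ l =>
        have := ih l s t (by simpa [List.replicate_succ] using h)
        exact ⟨by rw [this.1], this.2⟩
  have votes_eq : ∀ (m : ℕ) (s t : List (WeakOrder (Fin m))),
      s.flatMap WeakOrder.encode = t.flatMap WeakOrder.encode → s = t := by
    intro m s
    induction s with
    | nil =>
      intro t h
      cases t with
      | nil => rfl
      | cons w t => simp [WeakOrder.encode] at h
    | cons v s ih =>
      intro t h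
      cases t with
      | nil => simp [WeakOrder.encode] at h
      | cons w t =>
        simp only [List.flatMap_cons] at h
        have h' := List.append_inj h (by simp [WeakOrder.length_encode])
        rw [WeakOrder.encode_injective h'.1, ih t h'.2]
  rintro ⟨m, s⟩ ⟨n, t⟩ h
  obtain ⟨h1, h2⟩ := key m n _ _ h
  subst h1
  rw [votes_eq m s t h2]

open Classical in
/-- The decision problem `p`, with inputs presented as strings through `enc`, is decidable in
polynomial time: some (multi-stack) Turing machine halts on every input `enc a` within a number
of steps bounded by a polynomial in the length of `enc a`, with output the truth value of `p a`. -/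
def DecidableInPolyTime {α Γ : Type} (enc : α → List Γ) (p : α → Prop) : Prop :=
  Nonempty (Turing.TM2ComputableInPolyTime enc Computability.encodeBool fun a => decide (p a))

/-! The combinatorial core is a reduction to arranging sets as intervals. A vote with a unique top
is single-peaked with outside options on an axis exactly if certain sets of candidates are intervals
of the axis: all upper sets `{x | x ≥ d}`, and, for `d` not at the bottom, the candidates better
than `d` together with `d` alone. The second kind forces tied candidates above the bottom onto
opposite sides of the peak; bottom candidates are exempt, since they can serve as outside options
(`isSinglePeakedWithOutsideOptions_of_ordering`, `IsSinglePeakedWithOutsideOptions.lt_of_lt`).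

If `S` has to be an interval, `a, b ∈ S` and `c ∉ S`, then `a` and `b` lie on the same side of `c`,
so the order of `(a, c)` forces that of `(b, c)`. These forcing steps divide the ordered pairs into
classes. An ordering in which all the sets are intervals exists if and only if no pair of distinct
elements is in the class of its reverse. Necessity is clear. For sufficiency, each class and its
reverse are oriented so that their lexicographically least increasing pair keeps its order. The
orientation respects the intervals by construction; the point is that it has no 3-cycles, which
follows from `Linked.triangle`, an analogue of the triangle lemma for implication classes of
comparability graphs. Together this gives the criterion `Profile.exists_axis_iff`: every vote has a
unique top, and reachability in a graph on the `m * m` pairs of candidates never leads from a pair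
of distinct candidates to its reverse.

This criterion is tested by a program in a small language of bounded loops. Loop programs are
compiled to structured stack programs and those to multi-stack Turing machines, with explicit step
counts. The counts are polynomial because lengths of registers may be turned into loop bounds only
outside loops. The decision program marks the pairs reachable from each given pair by `m * m` rounds
of passing marks along all edges, reading the votes directly from the input string. -/

/-! ### Structured stack programs and their translation to multi-stack Turing machines -/

/-- Structured programs over stacks indexed by `K`, with stack symbols in `A` and a finite
memory `σ`. -/
inductive StackProgram (K A σ : Type) : Type
  | push (k : K) (f : σ → A)
  | pop (k : K) (f : σ → Option A → σ)
  | load (f : σ → σ)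
  | seq (p q : StackProgram K A σ)
  | ite (b : σ → Bool) (p q : StackProgram K A σ)
  | repeatWhile (b : σ → Bool) (p : StackProgram K A σ)

namespace StackProgram

variable {K A σ : Type}

/-- `Exec p x y n`: started in the state `x`, the program `p` terminates in the state `y` after
`n` machine steps. -/
inductive Exec [DecidableEq K] :
    StackProgram K A σ → σ × (K → List A) → σ × (K → List A) → ℕ → Prop
  | push (k f s S) : Exec (.push k f) (s, S) (s, Function.update S k (f s :: S k)) 1
  | pop (k f s S) :
      Exec (.pop k f) (s, S) (f s (S k).head?, Function.update S k (S k).tail) 1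
  | load (f s S) : Exec (.load f) (s, S) (f s, S) 1
  | seq {p q x y z m n} : Exec p x y m → Exec q y z n → Exec (.seq p q) x z (m + n)
  | ite_true {b p q x y n} : b x.1 = true → Exec p x y n → Exec (.ite b p q) x y (n + 1)
  | ite_false {b p q x y n} : b x.1 = false → Exec q x y n → Exec (.ite b p q) x y (n + 1)
  | while_true {b p x y z m n} : b x.1 = true → Exec p x y m → Exec (.repeatWhile b p) y z n →
      Exec (.repeatWhile b p) x z (1 + m + n)
  | while_false {b p x} : b x.1 = false → Exec (.repeatWhile b p) x x 1

/-- The control points of a program. -/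
def Label : StackProgram K A σ → Type
  | .push _ _ => Unit
  | .pop _ _ => Unit
  | .load _ => Unit
  | .seq p q => p.Label ⊕ q.Label
  | .ite _ p q => Option (p.Label ⊕ q.Label)
  | .repeatWhile _ p => Option p.Label

/-- A program has finitely many control points. -/
@[reducible]
def labelFintype : (p : StackProgram K A σ) → Fintype p.Label
  | .push _ _ => inferInstanceAs (Fintype Unit)
  | .pop _ _ => inferInstanceAs (Fintype Unit)
  | .load _ => inferInstanceAs (Fintype Unit)
  | .seq p q =>
    letI := p.labelFintype; letI := q.labelFintype
    inferInstanceAs (Fintype (p.Label ⊕ q.Label))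
  | .ite _ p q =>
    letI := p.labelFintype; letI := q.labelFintype
    inferInstanceAs (Fintype (Option (p.Label ⊕ q.Label)))
  | .repeatWhile _ p =>
    letI := p.labelFintype
    inferInstanceAs (Fintype (Option p.Label))

/-- The control point at which a program starts. -/
def entry : (p : StackProgram K A σ) → p.Label
  | .push _ _ => ()
  | .pop _ _ => ()
  | .load _ => ()
  | .seq p _ => .inl p.entry
  | .ite _ _ _ => none
  | .repeatWhile _ _ => none

/-- The stack alphabets of the machine: the stacks of the program and one more for the output. -/
abbrev Alphabet (K A : Type) : Option K → Type
  | none => Bool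
  | some _ => A

/-- The machine code of a program. Its control points are mapped into the labels of the machine
by `e`; when it terminates, control passes to the label `exit`. -/
def code {Λ : Type} : (p : StackProgram K A σ) → (p.Label → Λ) → Λ → p.Label →
    Turing.TM2.Stmt (Alphabet K A) Λ σ
  | .push k f, _, exit, _ => .push (some k) f (.goto fun _ => exit)
  | .pop k f, _, exit, _ => .pop (some k) f (.goto fun _ => exit)
  | .load f, _, exit, _ => .load f (.goto fun _ => exit)
  | .seq p q, e, _, .inl l => p.code (fun l => e (.inl l)) (e (.inr q.entry)) l
  | .seq _ q, e, exit, .inr l => q.code (fun l => e (.inr l)) exit l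
  | .ite b p q, e, _, none =>
    .branch b (.goto fun _ => e (some (.inl p.entry))) (.goto fun _ => e (some (.inr q.entry)))
  | .ite _ p _, e, exit, some (.inl l) => p.code (fun l => e (some (.inl l))) exit l
  | .ite _ _ q, e, exit, some (.inr l) => q.code (fun l => e (some (.inr l))) exit l
  | .repeatWhile b p, e, exit, none =>
    .branch b (.goto fun _ => e (some p.entry)) (.goto fun _ => exit)
  | .repeatWhile _ p, e, _, some l => p.code (fun l => e (some l)) (e none) l

/-- The stacks of the machine, the output stack being empty. -/
def contents (S : K → List A) : (k : Option K) → List (Alphabet K A k)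
  | none => []
  | some k => S k

/-- The configuration of the machine at the label `l` in the state `x`. -/
def config {Λ : Type} (l : Option Λ) (x : σ × (K → List A)) :
    Turing.TM2.Cfg (Alphabet K A) Λ σ :=
  ⟨l, x.1, contents x.2⟩

variable [DecidableEq K]

theorem update_contents (S : K → List A) (k : K) (l : List A) :
    Function.update (contents S) (some k) l = contents (Function.update S k l) := by
  funext j
  rcases j with _ | j
  · rfl
  · by_cases h : j = k
    · subst h; simp [contents]
    · have h' : some j ≠ some k := by simpa using h
      simp [contents, h, h']

/-- `n` steps of the machine `M` lead from `c` to `d`. -/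
def Steps {Λ : Type} (M : Λ → Turing.TM2.Stmt (Alphabet K A) Λ σ) (n : ℕ)
    (c d : Turing.TM2.Cfg (Alphabet K A) Λ σ) : Prop :=
  (flip bind (Turing.TM2.step M))^[n] (some c) = some d

theorem Steps.trans {Λ : Type} {M : Λ → Turing.TM2.Stmt (Alphabet K A) Λ σ} {m n : ℕ}
    {c d e : Turing.TM2.Cfg (Alphabet K A) Λ σ} (h : Steps M m c d) (h' : Steps M n d e) :
    Steps M (m + n) c e := by
  unfold Steps at *
  rw [Nat.add_comm, Function.iterate_add_apply, h, h']

theorem Steps.one {Λ : Type} {M : Λ → Turing.TM2.Stmt (Alphabet K A) Λ σ}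
    {c d : Turing.TM2.Cfg (Alphabet K A) Λ σ} (h : Turing.TM2.step M c = some d) :
    Steps M 1 c d := by
  simpa [Steps, flip] using h

/-- The machine `M` is arbitrary and only has to contain the code of `p` along `e`, with any `exit`.
This makes the induction work: a subprogram sits in the same machine along a restriction of `e`, the
first part of a sequence exits to the entry of the second, and a loop body exits to the test of its
loop. -/
theorem Exec.steps {Λ : Type} {M : Λ → Turing.TM2.Stmt (Alphabet K A) Λ σ}
    {p : StackProgram K A σ} {x y : σ × (K → List A)} {n : ℕ} (h : Exec p x y n)
    (e : p.Label → Λ) (exit : Λ) (hM : ∀ l, M (e l) = p.code e exit l) :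
    Steps M n (config (some (e p.entry)) x) (config (some exit) y) := by
  induction h generalizing exit with
  | push k f s S =>
    apply Steps.one
    simp only [config, Turing.TM2.step, hM, code, Turing.TM2.stepAux]
    congr 2
    exact update_contents S k _
  | pop k f s S =>
    apply Steps.one
    simp only [config, Turing.TM2.step, hM, code, Turing.TM2.stepAux]
    congr 2
    exact update_contents S k _
  | load f s S =>
    apply Steps.one
    simp only [config, Turing.TM2.step, hM, code, Turing.TM2.stepAux]
  | @seq p q x y z m n _ _ ih₁ ih₂ =>
    exact (ih₁ (fun l => e (.inl l)) (e (.inr q.entry)) fun l => hM (.inl l)).trans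
      (ih₂ (fun l => e (.inr l)) exit fun l => hM (.inr l))
  | @ite_true b p q x y n hb _ ih =>
    rw [Nat.add_comm]
    refine Steps.trans (Steps.one ?_)
      (ih (fun l => e (some (.inl l))) exit fun l => hM (some (.inl l)))
    simp only [config, Turing.TM2.step, entry]
    rw [hM none]
    simp [code, hb]
  | @ite_false b p q x y n hb _ ih =>
    rw [Nat.add_comm]
    refine Steps.trans (Steps.one ?_)
      (ih (fun l => e (some (.inr l))) exit fun l => hM (some (.inr l)))
    simp only [config, Turing.TM2.step, entry]
    rw [hM none]
    simp [code, hb]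
  | @while_true b p x y z m n hb _ _ ih₁ ih₂ =>
    refine (Steps.trans (Steps.one ?_)
      (ih₁ (fun l => e (some l)) (e none) fun l => hM (some l))).trans (ih₂ e exit hM)
    simp only [config, Turing.TM2.step, entry]
    rw [hM none]
    simp [code, hb]
  | @while_false b p x hb =>
    apply Steps.one
    simp only [config, Turing.TM2.step, entry]
    rw [hM none]
    simp [code, hb]

/-- The machine that runs the program `p` with its input on the stack `k`, and outputs the
bit `out s`, where `s` is the content of the memory at the end. -/
def toMachine [Fintype K] [Fintype σ] [Fintype A] (p : StackProgram K A σ) (k : K) (init : σ)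
    (out : σ → Bool) : Turing.FinTM2 where
  K := Option K
  k₀ := some k
  k₁ := none
  Γ := Alphabet K A
  Λ := Option p.Label
  main := some p.entry
  ΛFin := letI := p.labelFintype; inferInstance
  σ := σ
  initialState := init
  Γk₀Fin := inferInstanceAs (Fintype A)
  m
    | some l => p.code some none l
    | none => .push none out (.load (fun _ => init) .halt)

/-- A halting configuration with output must have all other stacks empty and the memory in its
initial state. The program is therefore required to end with empty stacks, and the one extra step at
the label `none` writes the answer and resets the memory. -/
theorem toMachine_outputs [Fintype K] [Fintype σ] [Fintype A] (p : StackProgram K A σ) (k : K)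
    (init : σ) (out : σ → Bool) (w : List A) (s : σ) (n : ℕ)
    (h : Exec p (init, Function.update (fun _ => []) k w) (s, fun _ => []) n) :
    Nonempty (Turing.TM2OutputsInTime (p.toMachine k init out) w (some [out s]) (n + 1)) := by
  have h₁ := Exec.steps (M := (p.toMachine k init out).m) h some none fun l => rfl
  have h₂ : Steps (p.toMachine k init out).m 1 (config (some none) (s, fun _ => []))
      (Turing.haltList (p.toMachine k init out) [out s]) := by
    apply Steps.one
    simp only [config, Turing.TM2.step, toMachine, Turing.TM2.stepAux, Turing.haltList]
    congr 2
    funext j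
    rcases j with _ | j
    · simp [contents]
      rfl
    · simp [contents]
  have h₃ := h₁.trans h₂
  refine ⟨⟨⟨n + 1, ?_⟩, le_rfl⟩⟩
  have h₄ : Turing.initList (p.toMachine k init out) w =
      config (some (some p.entry)) (init, Function.update (fun _ => []) k w) := by
    simp only [config, toMachine, Turing.initList]
    congr 1
    funext j
    rcases j with _ | j
    · simp [contents]
    · by_cases hj : j = k
      · subst hj
        simp [contents]
        rfl
      · simp [contents, hj]
  rw [h₄]
  exact h₃

end StackProgram

/-! ### Stack programs with a one-symbol buffer: draining, moving and counting -/

namespace StackProgram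

open Computability (Γ')

variable {K F : Type} [DecidableEq K]

/-- `p` leads from the state `x` to the state `y` within `n` steps. -/
def ExecWithin {A σ : Type} (p : StackProgram K A σ) (x y : σ × (K → List A)) (n : ℕ) : Prop :=
  ∃ m ≤ n, Exec p x y m

section

variable {A σ : Type} {p q : StackProgram K A σ} {x y z : σ × (K → List A)} {m n : ℕ}

theorem Exec.within (h : Exec p x y n) : ExecWithin p x y n := ⟨n, le_rfl, h⟩

theorem ExecWithin.mono (h : ExecWithin p x y m) (hmn : m ≤ n) : ExecWithin p x y n := by
  obtain ⟨k, hk, h⟩ := h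
  exact ⟨k, hk.trans hmn, h⟩

theorem ExecWithin.seq (h : ExecWithin p x y m) (h' : ExecWithin q y z n) :
    ExecWithin (.seq p q) x z (m + n) := by
  obtain ⟨k, hk, h⟩ := h
  obtain ⟨l, hl, h'⟩ := h'
  exact ⟨k + l, by omega, .seq h h'⟩

theorem ExecWithin.while_true {b : σ → Bool} (hb : b x.1 = true) (h : ExecWithin p x y m)
    (h' : ExecWithin (.repeatWhile b p) y z n) :
    ExecWithin (.repeatWhile b p) x z (1 + m + n) := by
  obtain ⟨k, hk, h⟩ := h
  obtain ⟨l, hl, h'⟩ := h'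
  exact ⟨1 + k + l, by omega, .while_true hb h h'⟩

theorem ExecWithin.ite_true {b : σ → Bool} (hb : b x.1 = true) (h : ExecWithin p x y n) :
    ExecWithin (.ite b p q) x y (n + 1) := by
  obtain ⟨k, hk, h⟩ := h
  exact ⟨k + 1, by omega, .ite_true hb h⟩

theorem ExecWithin.ite_false {b : σ → Bool} (hb : b x.1 = false) (h : ExecWithin q x y n) :
    ExecWithin (.ite b p q) x y (n + 1) := by
  obtain ⟨k, hk, h⟩ := h
  exact ⟨k + 1, by omega, .ite_false hb h⟩

end

/-- Programs over the alphabet `Γ'` whose memory holds, besides a value of `F`, the symbol read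
last. -/
abbrev BufferedProgram (K F : Type) := StackProgram K Γ' (F × Option Γ')

/-- Read the top of the stack `k` into the buffer and remove it. -/
def fetch (k : K) : BufferedProgram K F := .pop k fun s o => (s.1, o)

/-- Push the symbol in the buffer on the stack `k`. -/
def putBack (k : K) : BufferedProgram K F := .push k fun s => s.2.getD .blank

/-- Push the symbol `1`, the unit of unary counters, on the stack `k`. -/
def pushOne (k : K) : BufferedProgram K F := .push k fun _ => .bit true

/-- Forget the symbol in the buffer. -/
def resetBuffer : BufferedProgram K F := .load fun s => (s.1, none)

/-- Pop the symbols of the stack `k` one after the other and run `p` after each. -/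
def drain (k : K) (p : BufferedProgram K F) : BufferedProgram K F :=
  .seq (fetch k) (.repeatWhile (fun s => s.2.isSome) (.seq p (fetch k)))

theorem exec_fetch (k : K) (a : F) (o : Option Γ') (S : K → List Γ') :
    ExecWithin (fetch k) ((a, o), S) ((a, (S k).head?), Function.update S k (S k).tail) 1 :=
  (Exec.pop k _ _ S).within

theorem exec_putBack (k : K) (a : F) (c : Γ') (S : K → List Γ') :
    ExecWithin (putBack k) ((a, some c), S) ((a, some c), Function.update S k (c :: S k)) 1 :=
  (Exec.push k _ _ S).within

theorem exec_pushOne (k : K) (a : F) (o : Option Γ') (S : K → List Γ') :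
    ExecWithin (pushOne k) ((a, o), S) ((a, o), Function.update S k (.bit true :: S k)) 1 :=
  (Exec.push k _ _ S).within

theorem exec_resetBuffer (a : F) (o : Option Γ') (S : K → List Γ') :
    ExecWithin resetBuffer ((a, o), S) ((a, none), S) 1 :=
  (Exec.load _ _ S).within

/-- If `p` changes the stacks by `g c` when the symbol `c` is in the buffer, draining `k` composes
these changes. -/
theorem exec_drain (k : K) (p : BufferedProgram K F) (a : F) (T : ℕ)
    (g : Γ' → (K → List Γ') → K → List Γ')
    (hg : ∀ c S l, g c (Function.update S k l) = Function.update (g c S) k l)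
    (hp : ∀ c S, ExecWithin p ((a, some c), S) ((a, some c), g c S) T)
    (l : List Γ') (o : Option Γ') (S : K → List Γ') :
    ExecWithin (drain k p) ((a, o), Function.update S k l)
      ((a, none), Function.update (l.foldl (fun S c => g c S) S) k []) (l.length * (T + 2) + 2) := by
  -- At each test of the loop the next symbol is already in the buffer, so the state is described by
  -- the head of `l` in the buffer and its tail on the stack. Each symbol costs a test, a run of `p`
  -- and a fetch.
  have loop : ∀ (l : List Γ') (S : K → List Γ'),
      ExecWithin (.repeatWhile (fun s => s.2.isSome) (.seq p (fetch k)))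
        ((a, l.head?), Function.update S k l.tail)
        ((a, none), Function.update (l.foldl (fun S c => g c S) S) k [])
        (l.length * (T + 2) + 1) := by
    intro l
    induction l with
    | nil => intro S; exact ⟨1, by simp, .while_false rfl⟩
    | cons c l ih =>
      intro S
      have h₁ := hp c (Function.update S k l)
      rw [hg] at h₁
      have h₂ := exec_fetch k a (some c) (Function.update (g c S) k l)
      simp only [Function.update_self, Function.update_idem] at h₂
      refine (ExecWithin.while_true rfl (h₁.seq h₂) (ih (g c S))).mono ?_
      simp only [List.length_cons]
      ring_nf
      omega
  have h := exec_fetch k a o (Function.update S k l)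
  simp only [Function.update_self, Function.update_idem] at h
  exact (h.seq (loop l S)).mono (by omega)

theorem exec_drain_of_eq (k : K) (p : BufferedProgram K F) (a : F) (T : ℕ)
    (g : Γ' → (K → List Γ') → K → List Γ')
    (hg : ∀ c S l, g c (Function.update S k l) = Function.update (g c S) k l)
    (hp : ∀ c S, ExecWithin p ((a, some c), S) ((a, some c), g c S) T)
    (o : Option Γ') (S : K → List Γ') :
    ExecWithin (drain k p) ((a, o), S)
      ((a, none), Function.update ((S k).foldl (fun S c => g c S) S) k [])
      ((S k).length * (T + 2) + 2) := by
  simpa using exec_drain k p a T g hg hp (S k) o S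

/-- Empty the stack `k`. -/
def clearStack (k : K) : BufferedProgram K F := drain k (.load id)

theorem exec_clearStack (k : K) (a : F) (o : Option Γ') (S : K → List Γ') :
    ExecWithin (clearStack k) ((a, o), S) ((a, none), Function.update S k [])
      (3 * (S k).length + 2) := by
  have h := exec_drain_of_eq k (.load id) a 1 (fun _ S => S) (fun _ _ _ => rfl)
    (fun c S => (Exec.load _ _ S).within) o S
  rw [List.foldl_fixed] at h
  exact h.mono (by omega)

/-- Move the stack `k` symbol by symbol onto the stack `j`. -/
def moveStack (k j : K) : BufferedProgram K F := drain k (putBack j)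

theorem exec_moveStack {k j : K} (hkj : k ≠ j) (a : F) (o : Option Γ') (S : K → List Γ') :
    ExecWithin (moveStack k j) ((a, o), S)
      ((a, none), Function.update (Function.update S j ((S k).reverse ++ S j)) k [])
      (3 * (S k).length + 2) := by
  have h := exec_drain_of_eq k (putBack j) a 1
    (fun c S => Function.update S j (c :: S j))
    (fun c S l => by rw [Function.update_of_ne hkj.symm, Function.update_comm hkj])
    (fun c S => exec_putBack j a c S) o S
  have key : ∀ (l : List Γ') (S : K → List Γ'),
      l.foldl (fun S c => Function.update S j (c :: S j)) S =
        Function.update S j (l.reverse ++ S j) := by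
    intro l
    induction l with
    | nil => intro S; simp
    | cons c l ih => intro S; simp [ih]
  rw [key] at h
  exact h.mono (by omega)

/-- Move the stack `k` onto the stack `j` and push as many units on the stack `i`. -/
def moveCounting (k j i : K) : BufferedProgram K F := drain k (.seq (putBack j) (pushOne i))

theorem exec_moveCounting {k j i : K} (hkj : k ≠ j) (hki : k ≠ i) (hij : i ≠ j) (a : F)
    (o : Option Γ') (S : K → List Γ') :
    ExecWithin (moveCounting k j i) ((a, o), S)
      ((a, none), Function.update (Function.update (Function.update S j ((S k).reverse ++ S j)) i
        (List.replicate (S k).length (.bit true) ++ S i)) k []) (4 * (S k).length + 2) := by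
  have h := exec_drain_of_eq k (.seq (putBack j) (pushOne i)) a 2
    (fun c S => Function.update (Function.update S j (c :: S j)) i (.bit true :: S i))
    (fun c S l => by
      rw [Function.update_of_ne hkj.symm, Function.update_of_ne hki.symm,
        Function.update_comm hkj, Function.update_comm hki])
    (fun c S => by
      have h := (exec_putBack j a c S).seq (exec_pushOne i a (some c) _)
      rwa [Function.update_of_ne hij] at h) o S
  have key : ∀ (l : List Γ') (S : K → List Γ'),
      l.foldl (fun S c => Function.update (Function.update S j (c :: S j)) i (.bit true :: S i)) S =
        Function.update (Function.update S j (l.reverse ++ S j)) i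
          (List.replicate l.length (.bit true) ++ S i) := by
    intro l
    induction l with
    | nil => intro S; simp
    | cons c l ih =>
      intro S
      rw [List.foldl_cons, ih]
      have e : List.replicate l.length (Γ'.bit true) ++ Γ'.bit true :: S i =
          List.replicate (c :: l).length (Γ'.bit true) ++ S i := by
        rw [List.length_cons, List.replicate_succ', List.append_assoc]; rfl
      simp only [Function.update_self, Function.update_of_ne hij.symm, e]
      rw [Function.update_comm hij, Function.update_idem, Function.update_idem]
      simp
  rw [key] at h
  exact h.mono (by omega)

end StackProgram

/-! ### A language of bounded loops and its compilation to stack programs -/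

open Computability (Γ') in
/-- A language of bounded loops. The variables in `V` hold natural numbers and are only bound by
loops and by `letLength`, the registers in `R` hold strings, and `F` is a finite memory.
- `access r i f g`: read position `length i` of the register `r`, change the memory by `f`
  and the symbol at this position by `g`;
- `forUpTo x v p`: run `p` for `x = 0, …, v - 1`;
- `letLength x r p`: run `p` with `x` standing for the length of the register `r`. -/
inductive LoopProgram (V R F : Type) : Type
  | load (f : F → F)
  | push (r : R) (g : F → Γ')
  | clear (r : R)
  | access (r i : R) (f : F → Option Γ' → F) (g : F → Γ' → Γ')
  | seq (p q : LoopProgram V R F)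
  | ite (b : F → Bool) (p q : LoopProgram V R F)
  | forUpTo (x v : V) (p : LoopProgram V R F)
  | letLength (x : V) (r : R) (p : LoopProgram V R F)

namespace LoopProgram

open Computability (Γ')
open StackProgram

variable {V R F : Type}

/-- The meaning of a program: the change of memory and registers for given values of the
variables. -/
def run [DecidableEq V] [DecidableEq R] : LoopProgram V R F → (V → ℕ) → F × (R → List Γ') → F × (R → List Γ')
  | .load f, _, s => (f s.1, s.2)
  | .push r g, _, s => (s.1, Function.update s.2 r (g s.1 :: s.2 r))
  | .clear r, _, s => (s.1, Function.update s.2 r [])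
  | .access r i f g, _, s =>
    (f s.1 (s.2 r)[(s.2 i).length]?, Function.update s.2 r
      ((s.2 r).modify (s.2 i).length (g (f s.1 (s.2 r)[(s.2 i).length]?))))
  | .seq p q, env, s => q.run env (p.run env s)
  | .ite b p q, env, s => if b s.1 then p.run env s else q.run env s
  | .forUpTo x v p, env, s =>
    (List.range (env v)).foldl (fun s i => p.run (Function.update env x i) s) s
  | .letLength x r p, env, s => p.run (Function.update env x (s.2 r).length) s

/-- The program does not use `letLength`. -/
def LetFree : LoopProgram V R F → Prop
  | .load _ => True
  | .push _ _ => True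
  | .clear _ => True
  | .access _ _ _ _ => True
  | .seq p q => p.LetFree ∧ q.LetFree
  | .ite _ p q => p.LetFree ∧ q.LetFree
  | .forUpTo _ _ p => p.LetFree
  | .letLength _ _ _ => False

/-- No variable is bound while it is in the list `B` of variables in use, and the bodies of loops
are free of `letLength`. -/
def WellFormed : LoopProgram V R F → List V → Prop
  | .load _, _ => True
  | .push _ _, _ => True
  | .clear _, _ => True
  | .access _ _ _ _, _ => True
  | .seq p q, B => p.WellFormed B ∧ q.WellFormed B
  | .ite _ p q, B => p.WellFormed B ∧ q.WellFormed B
  | .forUpTo x _ p, B => x ∉ B ∧ p.LetFree ∧ p.WellFormed (x :: B)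
  | .letLength x _ p, B => x ∉ B ∧ p.WellFormed (x :: B)

/-- The stacks used to run a program: one for each variable, one for each register, a control
stack (`true`) for the loops and an auxiliary stack (`false`). -/
abbrev Stack (V R : Type) := V ⊕ R ⊕ Bool

/-- The contents of the stacks. -/
def store (vs : V → List Γ') (rs : R → List Γ') (γ τ : List Γ') : Stack V R → List Γ' :=
  Sum.elim vs (Sum.elim rs fun b => if b then γ else τ)

section

variable (vs : V → List Γ') (rs : R → List Γ') (γ τ : List Γ')

@[simp] theorem store_var (v : V) : store vs rs γ τ (.inl v) = vs v := rfl

@[simp] theorem store_reg (r : R) : store vs rs γ τ (.inr (.inl r)) = rs r := rfl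

@[simp] theorem store_control : store vs rs γ τ (.inr (.inr true)) = γ := rfl

@[simp] theorem store_auxiliary : store vs rs γ τ (.inr (.inr false)) = τ := rfl

variable [DecidableEq V] [DecidableEq R]

@[simp] theorem update_store_var (v : V) (l : List Γ') :
    Function.update (store vs rs γ τ) (.inl v) l = store (Function.update vs v l) rs γ τ := by
  funext k
  rcases k with k | k | k
  · by_cases h : k = v
    · subst h; simp
    · simp [h]
  · simp
  · cases k <;> simp

@[simp] theorem update_store_reg (r : R) (l : List Γ') :
    Function.update (store vs rs γ τ) (.inr (.inl r)) l =
      store vs (Function.update rs r l) γ τ := by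
  funext k
  rcases k with k | k | k
  · simp
  · by_cases h : k = r
    · subst h; simp
    · simp [h]
  · cases k <;> simp

@[simp] theorem update_store_control (l : List Γ') :
    Function.update (store vs rs γ τ) (.inr (.inr true)) l = store vs rs l τ := by
  funext k
  rcases k with k | k | k
  · simp
  · simp
  · cases k <;> simp

@[simp] theorem update_store_auxiliary (l : List Γ') :
    Function.update (store vs rs γ τ) (.inr (.inr false)) l = store vs rs γ l := by
  funext k
  rcases k with k | k | k
  · simp
  · simp
  · cases k <;> simp

end

/-- Push a separator and a copy in unary of the length of the stack `k` on the control stack. -/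
def copyLength (k : Stack V R) : BufferedProgram (Stack V R) F :=
  .seq (.push (.inr (.inr true)) fun _ => .blank) <|
    .seq (moveStack k (.inr (.inr false))) (moveCounting (.inr (.inr false)) k (.inr (.inr true)))

/-- Run `p` as many times as the stack `k` has symbols. -/
def countdown (k : Stack V R) (p : BufferedProgram (Stack V R) F) :
    BufferedProgram (Stack V R) F :=
  .seq (copyLength k) <| .seq (fetch (.inr (.inr true))) <|
    .seq (.repeatWhile (fun s => decide (s.2 = some (.bit true)))
      (.seq resetBuffer (.seq p (fetch (.inr (.inr true)))))) resetBuffer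

variable [DecidableEq V] [DecidableEq R]

/-- Moving `k` to the auxiliary stack and back reverses it twice, so it is restored while its length
is counted. The blank below the copy marks the end of this counter, so the counters of nested loops
can share the control stack. -/
theorem exec_copyLength (k : Stack V R) (hk : ∀ b, k ≠ .inr (.inr b)) (a : F) (o : Option Γ')
    (vs : V → List Γ') (rs : R → List Γ') (γ : List Γ') :
    ExecWithin (copyLength k) ((a, o), store vs rs γ [])
      ((a, none), store vs rs
        (List.replicate (store vs rs γ [] k).length (.bit true) ++ .blank :: γ) [])
      (7 * (store vs rs γ [] k).length + 5) := by
  have h₁ : ExecWithin (.push (.inr (.inr true)) fun _ => Γ'.blank) ((a, o), store vs rs γ [])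
      ((a, o), Function.update (store vs rs γ []) (.inr (.inr true)) (.blank :: γ)) 1 :=
    (Exec.push _ _ (a, o) _).within
  have h₂ := exec_moveStack (hk false) a o
    (Function.update (store vs rs γ []) (.inr (.inr true)) (.blank :: γ))
  have h₃ := exec_moveCounting (hk false).symm (i := .inr (.inr true)) (by simp) (hk true).symm a
    none (Function.update (Function.update (Function.update (store vs rs γ []) (.inr (.inr true))
      (.blank :: γ)) (.inr (.inr false)) (store vs rs γ [] k).reverse) k [])
  rcases k with v | r | b
  · simp at h₁ h₂ h₃ ⊢
    exact (h₁.seq (h₂.seq h₃)).mono (by omega)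
  · simp at h₁ h₂ h₃ ⊢
    exact (h₁.seq (h₂.seq h₃)).mono (by omega)
  · exact absurd rfl (hk b)

/-- The states `(fl i, vs i, rs i, τ i)` are those after `i` runs of the body. -/
theorem exec_countdown (k : Stack V R) (hk : ∀ b, k ≠ .inr (.inr b))
    (p : BufferedProgram (Stack V R) F) (n T : ℕ) (fl : ℕ → F) (vs : ℕ → V → List Γ')
    (rs : ℕ → R → List Γ') (τ : ℕ → List Γ') (hτ : τ 0 = []) (γ : List Γ')
    (hn : (store (vs 0) (rs 0) γ [] k).length = n)
    (hp : ∀ i < n, ∀ γ, ExecWithin p ((fl i, none), store (vs i) (rs i) γ (τ i))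
      ((fl (i + 1), none), store (vs (i + 1)) (rs (i + 1)) γ (τ (i + 1))) T) :
    ExecWithin (countdown k p) ((fl 0, none), store (vs 0) (rs 0) γ [])
      ((fl n, none), store (vs n) (rs n) γ (τ n)) (n * (T + 3) + 7 * n + 8) := by
  -- Induction on the number `j` of rounds left, so that `n - j` rounds have been completed. The
  -- loop ends when the separator `.blank` arrives in the buffer. Each round costs a test, a reset
  -- and a fetch besides the body.
  have loop : ∀ j ≤ n,
      ExecWithin (.repeatWhile (fun s => decide (s.2 = some (.bit true)))
        (.seq resetBuffer (.seq p (fetch (.inr (.inr true))))))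
        ((fl (n - j), (List.replicate j (Γ'.bit true) ++ .blank :: γ).head?), store (vs (n - j))
          (rs (n - j)) (List.replicate j (Γ'.bit true) ++ .blank :: γ).tail (τ (n - j)))
        ((fl n, some .blank), store (vs n) (rs n) γ (τ n)) (j * (T + 3) + 1) := by
    intro j
    induction j with
    | zero => intro _; exact ⟨1, by simp, .while_false (by simp)⟩
    | succ j ih =>
      intro hj
      have e : n - j = n - (j + 1) + 1 := by omega
      have h₁ := hp (n - (j + 1)) (by omega) (List.replicate j (Γ'.bit true) ++ .blank :: γ)
      rw [← e] at h₁
      have h₂ := exec_fetch (.inr (.inr true)) (fl (n - j)) none (store (vs (n - j)) (rs (n - j))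
        (List.replicate j (Γ'.bit true) ++ .blank :: γ) (τ (n - j)))
      simp only [store_control, update_store_control] at h₂
      refine (ExecWithin.while_true (by simp [List.replicate_succ])
        ((exec_resetBuffer _ _ _).seq (h₁.seq h₂)) (ih (by omega))).mono ?_
      ring_nf
      omega
  have h₁ := exec_copyLength k hk (fl 0) none (vs 0) (rs 0) γ
  rw [hn] at h₁
  have h₂ := exec_fetch (.inr (.inr true)) (fl 0) none (store (vs 0) (rs 0)
    (List.replicate n (Γ'.bit true) ++ .blank :: γ) [])
  simp only [store_control, update_store_control] at h₂
  have h₃ := loop n le_rfl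
  rw [Nat.sub_self, hτ] at h₃
  exact (h₁.seq (h₂.seq (h₃.seq (exec_resetBuffer _ _ _)))).mono (by omega)

/-- The implementation of `access`. -/
def compileAccess (r i : R) (f : F → Option Γ' → F) (g : F → Γ' → Γ') :
    BufferedProgram (Stack V R) F :=
  .seq (countdown (.inr (.inl i)) (.seq (fetch (.inr (.inl r)))
    (.seq (.ite (fun s => s.2.isSome) (putBack (.inr (.inr false))) (.load id)) resetBuffer))) <|
  .seq (fetch (.inr (.inl r))) <|
  .seq (.load fun s => (f s.1 s.2, s.2)) <|
  .seq (.ite (fun s => s.2.isSome) (.push (.inr (.inl r)) fun s => g s.1 (s.2.getD .blank))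
    (.load id))
  (moveStack (.inr (.inr false)) (.inr (.inl r)))

/-- The translation of loop programs to stack programs. -/
def compile : LoopProgram V R F → BufferedProgram (Stack V R) F
  | .load f => .load fun s => (f s.1, none)
  | .push r g => .push (.inr (.inl r)) fun s => g s.1
  | .clear r => clearStack (.inr (.inl r))
  | .access r i f g => compileAccess r i f g
  | .seq p q => .seq p.compile q.compile
  | .ite b p q => .ite (fun s => b s.1) p.compile q.compile
  | .forUpTo x v p =>
    .seq (countdown (.inl v) (.seq p.compile (pushOne (.inl x)))) (clearStack (.inl x))
  | .letLength x r p =>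
    .seq (countdown (.inr (.inl r)) (pushOne (.inl x))) (.seq p.compile (clearStack (.inl x)))

/-- The first `n` symbols of `r` are shunted onto the auxiliary stack, which exposes position `n`,
and moved back afterwards. After `j` rounds `r` holds `l.drop j` and the auxiliary stack the reverse
of `l.take j`. If `r` has at most `n` symbols, the fetch yields `none` and nothing is pushed, in
agreement with `List.modify` beyond the end. -/
theorem exec_compileAccess (r i : R) (f : F → Option Γ' → F) (g : F → Γ' → Γ') (a : F)
    (vs : V → List Γ') (rs : R → List Γ') (γ : List Γ') (L : ℕ) (hL : ∀ r, (rs r).length ≤ L) :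
    ExecWithin (compileAccess r i f g) ((a, none), store vs rs γ [])
      ((f a (rs r)[(rs i).length]?, none), store vs (Function.update rs r
        ((rs r).modify (rs i).length (g (f a (rs r)[(rs i).length]?)))) γ [])
      (20 * L + 20) := by
  set n := (rs i).length with hn
  set l := rs r with hl
  have h₁ := exec_countdown (.inr (.inl i)) (by simp)
    (.seq (fetch (.inr (.inl r)))
      (.seq (.ite (fun s => s.2.isSome) (putBack (.inr (.inr false))) (.load id)) resetBuffer))
    n 4 (fun _ => a) (fun _ => vs) (fun j => Function.update rs r (l.drop j))
    (fun j => (l.take j).reverse) rfl γ (by simp [hl, hn]) (by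
      intro j hj γ
      have h₁ := exec_fetch (.inr (.inl r)) a none
        (store vs (Function.update rs r (l.drop j)) γ (l.take j).reverse)
      simp only [store_reg, Function.update_self, update_store_reg, Function.update_idem,
        List.head?_drop, List.tail_drop] at h₁
      refine (h₁.seq (ExecWithin.seq (m := 2) (y := ((a, l[j]?), store vs (Function.update rs r
        (l.drop (j + 1))) γ (l.take (j + 1)).reverse)) ?_ (exec_resetBuffer _ _ _))).mono le_rfl
      rw [List.take_add_one]
      rcases e : l[j]? with _ | c
      · refine ExecWithin.ite_false rfl ?_
        simpa using (Exec.load id _ _).within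
      · refine ExecWithin.ite_true rfl ?_
        have h := exec_putBack (.inr (.inr false)) a c (store vs (Function.update rs r
          (l.drop (j + 1))) γ (l.take j).reverse)
        simpa using h)
  simp only [List.drop_zero, hl, Function.update_eq_self] at h₁
  rw [← hl] at h₁
  have h₂ := exec_fetch (.inr (.inl r)) a none
    (store vs (Function.update rs r (l.drop n)) γ (l.take n).reverse)
  simp only [store_reg, Function.update_self, update_store_reg, Function.update_idem,
    List.head?_drop, List.tail_drop] at h₂
  set b := f a l[n]? with hb
  have h₃ : ExecWithin (.load fun s => (f s.1 s.2, s.2))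
      ((a, l[n]?), store vs (Function.update rs r (l.drop (n + 1))) γ (l.take n).reverse)
      ((b, l[n]?), store vs (Function.update rs r (l.drop (n + 1))) γ (l.take n).reverse) 1 :=
    (Exec.load _ _ _).within
  have h₄ : ExecWithin (.ite (fun s => s.2.isSome)
      (.push (.inr (.inl r)) fun s => g s.1 (s.2.getD .blank)) (.load id))
      ((b, l[n]?), store vs (Function.update rs r (l.drop (n + 1))) γ (l.take n).reverse)
      ((b, l[n]?), store vs (Function.update rs r ((l.drop n).modifyHead (g b))) γ
        (l.take n).reverse) 2 := by
    rcases e : l[n]? with _ | c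
    · refine ExecWithin.ite_false rfl ?_
      have e₁ : l.length ≤ n := by simpa using e
      rw [List.drop_eq_nil_of_le e₁, List.drop_eq_nil_of_le (by omega)]
      exact (Exec.load id _ _).within
    · refine ExecWithin.ite_true rfl ?_
      obtain ⟨hlt, rfl⟩ := List.getElem?_eq_some_iff.1 e
      have h := (Exec.push (.inr (.inl r)) (fun s => g s.1 (s.2.getD .blank)) (b, some l[n])
        (store vs (Function.update rs r (l.drop (n + 1))) γ (l.take n).reverse)).within
      rw [List.drop_eq_getElem_cons hlt, List.modifyHead_cons]
      simpa only [store_reg, Function.update_self, update_store_reg, Function.update_idem,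
        Option.getD_some] using h
  have h₅ := exec_moveStack (k := .inr (.inr false)) (j := .inr (.inl r)) (by simp) b l[n]?
    (store vs (Function.update rs r ((l.drop n).modifyHead (g b))) γ (l.take n).reverse)
  simp only [store_reg, store_auxiliary, Function.update_self, update_store_reg,
    Function.update_idem, update_store_auxiliary, List.reverse_reverse, List.length_reverse] at h₅
  rw [← List.modify_eq_take_drop] at h₅
  refine (h₁.seq (h₂.seq (h₃.seq (h₄.seq h₅)))).mono ?_
  have := hL i
  have := hL r
  have : (l.take n).length ≤ n := by simp
  omega

end LoopProgram

/-! ### Bounds on register lengths and running times -/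

namespace LoopProgram

open Computability (Γ')
open StackProgram

variable {V R F : Type}

/-- If the variables are at most `N` and the registers at most `L` long, the program makes the
registers at most this much longer. -/
def growth : LoopProgram V R F → ℕ → ℕ → ℕ
  | .load _, _, _ => 0
  | .push _ _, _, _ => 1
  | .clear _, _, _ => 0
  | .access _ _ _ _, _, _ => 0
  | .seq p q, N, L => p.growth N L + q.growth N (L + p.growth N L)
  | .ite _ p q, N, L => p.growth N L + q.growth N L
  | .forUpTo _ _ p, N, L => N * p.growth N L
  | .letLength _ _ p, N, L => p.growth (N + L) L

/-- If the variables are at most `N` and the registers at most `L` long, the translation of the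
program takes at most this many steps. -/
def cost : LoopProgram V R F → ℕ → ℕ → ℕ
  | .load _, _, _ => 1
  | .push _ _, _, _ => 1
  | .clear _, _, L => 3 * L + 2
  | .access _ _ _ _, _, L => 20 * L + 20
  | .seq p q, N, L => p.cost N L + q.cost N (L + p.growth N L)
  | .ite _ p q, N, L => p.cost N L + q.cost N L + 1
  | .forUpTo _ _ p, N, L => N * (p.cost N (L + N * p.growth N L) + 4) + 10 * N + 10
  | .letLength _ _ p, N, L => p.cost (N + L) L + 14 * L + 3 * N + 10

/-- Without `letLength`, loop bounds do not depend on the registers, so neither does the number of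
pushes. Consequently `n` runs of a loop body add at most `n` times a fixed amount; with `letLength`
in the body, a register could double in each round. -/
theorem LetFree.growth_eq {p : LoopProgram V R F} (hp : p.LetFree) (N L L' : ℕ) :
    p.growth N L = p.growth N L' := by
  induction p generalizing L L' with
  | seq p q ihp ihq => simp only [growth, ihp hp.1 L L', ihq hp.2 _ (L' + p.growth N L')]
  | ite b p q ihp ihq => simp only [growth, ihp hp.1 L L', ihq hp.2 L L']
  | forUpTo x v p ih => simp only [growth, ih hp L L']
  | letLength x r p => exact hp.elim
  | _ => rfl

variable [DecidableEq V] [DecidableEq R]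

theorem run_forUpTo_succ (p : LoopProgram V R F) (env : V → ℕ) (x : V) (s : F × (R → List Γ'))
    (n : ℕ) :
    (List.range (n + 1)).foldl (fun s i => p.run (Function.update env x i) s) s =
      p.run (Function.update env x n)
        ((List.range n).foldl (fun s i => p.run (Function.update env x i) s) s) := by
  rw [List.range_succ, List.foldl_append, List.foldl_cons, List.foldl_nil]

theorem update_le {env : V → ℕ} {N : ℕ} (hN : ∀ v, env v ≤ N) (x : V) {i : ℕ} (hi : i ≤ N)
    (v : V) : Function.update env x i v ≤ N := by
  by_cases h : v = x
  · subst h; simpa using hi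
  · simpa [h] using hN v

theorem update_eq_zero {env : V → ℕ} {B : List V} (hB : ∀ v, v ∉ B → env v = 0) (x : V) (i : ℕ)
    (v : V) (hv : v ∉ x :: B) : Function.update env x i v = 0 := by
  simp only [List.mem_cons, not_or] at hv
  simpa [hv.1] using hB v hv.2

theorem length_update_le {rs : R → List Γ'} {M : ℕ} (h : ∀ r, (rs r).length ≤ M) (r : R)
    {l : List Γ'} (hl : l.length ≤ M) (r' : R) : (Function.update rs r l r').length ≤ M := by
  by_cases e : r' = r
  · subst e; simpa using hl
  · simpa [e] using h r'

theorem length_run_le (p : LoopProgram V R F) (B : List V) (hp : p.WellFormed B) (env : V → ℕ)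
    (s : F × (R → List Γ')) (N L : ℕ) (hN : ∀ v, env v ≤ N) (hL : ∀ r, (s.2 r).length ≤ L)
    (r : R) : ((p.run env s).2 r).length ≤ L + p.growth N L := by
  induction p generalizing B env s N L r with
  | load f => simpa [run, growth] using hL r
  | push r' g =>
    exact length_update_le (fun r => (hL r).trans (by omega)) _ (by simpa [growth] using hL r') r
  | clear r' => exact length_update_le (fun r => (hL r).trans (by omega)) _ (by simp) r
  | access r' i f g => exact length_update_le hL _ (by simpa using hL r') r
  | seq p q ihp ihq =>
    simp only [run, growth, ← Nat.add_assoc]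
    exact ihq B hp.2 env _ N _ hN (ihp B hp.1 env s N L hN hL) r
  | ite b p q ihp ihq =>
    simp only [run, growth]
    split_ifs
    · exact (ihp B hp.1 env s N L hN hL r).trans (by omega)
    · exact (ihq B hp.2 env s N L hN hL r).trans (by omega)
  | forUpTo x v p ih =>
    have key : ∀ n ≤ env v, ∀ r, (((List.range n).foldl
        (fun s i => p.run (Function.update env x i) s) s).2 r).length ≤
          L + n * p.growth N L := by
      intro n
      induction n with
      | zero => intro _ r; simpa using hL r
      | succ n ihn =>
        intro hn r
        rw [run_forUpTo_succ]
        have h := ih _ hp.2.2 (Function.update env x n) _ N _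
          (update_le hN x (by have := hN v; omega)) (ihn (by omega)) r
        -- The registers are already longer than `L` here, but the growth of a body free of
        -- `letLength` does not depend on that.
        rw [hp.2.1.growth_eq N (L + n * p.growth N L) L] at h
        refine h.trans (le_of_eq ?_)
        ring
    refine (key (env v) le_rfl r).trans ?_
    simp only [growth]
    gcongr
    exact hN v
  | letLength x r' p ih =>
    exact ih _ hp.2 _ s (N + L) L (update_le (fun v => (hN v).trans (by omega)) x
      ((hL r').trans (by omega))) hL r

/-- The variables in unary. -/
def unary (env : V → ℕ) (v : V) : List Γ' := List.replicate (env v) (.bit true)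

theorem unary_update (env : V → ℕ) (x : V) (n : ℕ) :
    unary (Function.update env x n) = Function.update (unary env) x
      (List.replicate n (.bit true)) := by
  funext v
  by_cases h : v = x
  · subst h; simp [unary]
  · simp [unary, h]

theorem exec_clear_var (env : V → ℕ) (x : V) (hx : env x = 0) (n N : ℕ) (hn : n ≤ N) (a : F)
    (rs : R → List Γ') (γ : List Γ') :
    ExecWithin (clearStack (.inl x)) ((a, none), store (unary (Function.update env x n)) rs γ [])
      ((a, none), store (unary env) rs γ []) (3 * N + 2) := by
  have h := exec_clearStack (.inl x) a none (store (unary (Function.update env x n)) rs γ [])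
  rw [update_store_var, store_var, unary_update, Function.update_self, Function.update_idem,
    List.length_replicate] at h
  have e : Function.update (unary env) x [] = unary env := by
    conv_rhs => rw [← Function.update_eq_self x (unary env)]
    simp [unary, hx]
  rw [e, ← unary_update] at h
  exact h.mono (by omega)

/-- The invariant between commands is that the buffer and the auxiliary stack are empty and that the
stacks of variables not in use are empty. The control stack `γ` is arbitrary because the counters of
the enclosing loops lie on it. -/
theorem exec_compile (p : LoopProgram V R F) (B : List V) (hp : p.WellFormed B) (env : V → ℕ)
    (s : F × (R → List Γ')) (γ : List Γ') (N L : ℕ) (hB : ∀ v, v ∉ B → env v = 0)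
    (hN : ∀ v, env v ≤ N) (hL : ∀ r, (s.2 r).length ≤ L) :
    ExecWithin p.compile ((s.1, none), store (unary env) s.2 γ [])
      (((p.run env s).1, none), store (unary env) (p.run env s).2 γ []) (p.cost N L) := by
  induction p generalizing B env s γ N L with
  | load f => exact (Exec.load _ _ _).within
  | push r g =>
    have h := (Exec.push (.inr (.inl r)) (fun s : F × Option Γ' => g s.1) (s.1, none)
      (store (unary env) s.2 γ [])).within
    rw [update_store_reg] at h
    exact h
  | clear r =>
    have h := exec_clearStack (.inr (.inl r)) s.1 none (store (unary env) s.2 γ [])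
    rw [update_store_reg] at h
    have := hL r
    exact h.mono (by simp only [cost, store_reg]; omega)
  | access r i f g => exact exec_compileAccess r i f g s.1 (unary env) s.2 γ L hL
  | seq p q ihp ihq =>
    exact (ihp B hp.1 env s γ N L hB hN hL).seq
      (ihq B hp.2 env _ γ N _ hB hN (length_run_le p B hp.1 env s N L hN hL))
  | ite b p q ihp ihq =>
    simp only [run, compile, cost]
    split_ifs with h
    · refine ExecWithin.mono (ExecWithin.ite_true h (ihp B hp.1 env s γ N L hB hN hL)) ?_
      omega
    · refine ExecWithin.mono
        (ExecWithin.ite_false (by simpa using h) (ihq B hp.2 env s γ N L hB hN hL)) ?_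
      omega
  | forUpTo x v p ih =>
    set st : ℕ → F × (R → List Γ') :=
      fun n => (List.range n).foldl (fun s i => p.run (Function.update env x i) s) s with hst
    have hst' (n : ℕ) : st (n + 1) = p.run (Function.update env x n) (st n) :=
      run_forUpTo_succ p env x s n
    have hx : env x = 0 := hB x hp.1
    -- As `x` is not in use, its stack is empty and already represents the first value `0` of the
    -- loop variable. Each round pushes one unit, and the final `clearStack` restores the stack.
    have h0 : Function.update env x 0 = env := by rw [← hx, Function.update_eq_self]
    have hv := hN v
    have hlen : ∀ n ≤ env v, ∀ r, ((st n).2 r).length ≤ L + n * p.growth N L := by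
      intro n
      induction n with
      | zero => intro _ r; simpa [hst] using hL r
      | succ n ihn =>
        intro hn r
        rw [hst']
        have h' := length_run_le p _ hp.2.2 (Function.update env x n) _ N _
          (update_le hN x (by omega)) (ihn (by omega)) r
        rw [hp.2.1.growth_eq N (L + n * p.growth N L) L] at h'
        refine h'.trans (le_of_eq ?_)
        ring
    have h := exec_countdown (.inl v) (by simp) (.seq p.compile (pushOne (.inl x))) (env v)
      (p.cost N (L + N * p.growth N L) + 1) (fun i => (st i).1)
      (fun i => unary (Function.update env x i)) (fun i => (st i).2) (fun _ => []) rfl γ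
      (by rw [h0]; simp [unary]) (by
        intro i hi γ
        have h₁ := ih _ hp.2.2 (Function.update env x i) (st i) γ N (L + N * p.growth N L)
          (update_eq_zero hB x i) (update_le hN x (by omega))
          (fun r => (hlen i hi.le r).trans (by gcongr; omega))
        have h₂ := exec_pushOne (.inl x) (st (i + 1)).1 none
          (store (unary (Function.update env x i)) (st (i + 1)).2 γ [])
        rw [update_store_var, store_var, unary_update, Function.update_self, Function.update_idem,
          ← List.replicate_succ, ← unary_update, ← unary_update] at h₂
        rw [← hst'] at h₁
        exact h₁.seq h₂)
    have h₀ := exec_clear_var env x hx (env v) N hv (st (env v)).1 (st (env v)).2 γ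
    rw [h0] at h
    refine (h.seq h₀).mono ?_
    simp only [cost]
    have := Nat.mul_le_mul_right (p.cost N (L + N * p.growth N L) + 4) hv
    have e : p.cost N (L + N * p.growth N L) + 1 + 3 = p.cost N (L + N * p.growth N L) + 4 := rfl
    rw [e]
    omega
  | letLength x r p ih =>
    have hx : env x = 0 := hB x hp.1
    have h0 : Function.update env x 0 = env := by rw [← hx, Function.update_eq_self]
    have hr := hL r
    have h := exec_countdown (.inr (.inl r)) (by simp) (pushOne (.inl x)) (s.2 r).length 1
      (fun _ => s.1) (fun i => unary (Function.update env x i)) (fun _ => s.2) (fun _ => []) rfl γ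
      (by simp) (by
        intro i hi γ
        have h₂ := exec_pushOne (.inl x) s.1 none
          (store (unary (Function.update env x i)) s.2 γ [])
        rwa [update_store_var, store_var, unary_update, Function.update_self, Function.update_idem,
          ← List.replicate_succ, ← unary_update, ← unary_update] at h₂)
    have h₁ := ih _ hp.2 (Function.update env x (s.2 r).length) s γ (N + L) L
      (update_eq_zero hB x _)
      (update_le (fun v => (hN v).trans (by omega)) x (by omega)) hL
    have h₀ := exec_clear_var env x hx (s.2 r).length L hr
      (p.run (Function.update env x (s.2 r).length) s).1
      (p.run (Function.update env x (s.2 r).length) s).2 γ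
    rw [h0] at h
    refine (h.seq (h₁.seq h₀)).mono ?_
    simp only [cost]
    omega

end LoopProgram

/-! ### Loop programs run in polynomial time -/

namespace LoopProgram

open Computability (Γ')
open StackProgram

variable {V R F : Type}

/-- `growth` is built by sums, products and substitutions. The bounds `P` and `Q` vary in the
induction because `seq` and `letLength` evaluate subprograms at larger bounds. -/
theorem exists_polynomial_growth (p : LoopProgram V R F) (P Q : Polynomial ℕ) :
    ∃ T : Polynomial ℕ, ∀ n, T.eval n = p.growth (P.eval n) (Q.eval n) := by
  induction p generalizing P Q with
  | load f => exact ⟨0, by simp [growth]⟩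
  | push r g => exact ⟨1, by simp [growth]⟩
  | clear r => exact ⟨0, by simp [growth]⟩
  | access r i f g => exact ⟨0, by simp [growth]⟩
  | seq p q ihp ihq =>
    obtain ⟨T, hT⟩ := ihp P Q
    obtain ⟨U, hU⟩ := ihq P (Q + T)
    exact ⟨T + U, by simp [growth, hT, hU]⟩
  | ite b p q ihp ihq =>
    obtain ⟨T, hT⟩ := ihp P Q
    obtain ⟨U, hU⟩ := ihq P Q
    exact ⟨T + U, by simp [growth, hT, hU]⟩
  | forUpTo x v p ih =>
    obtain ⟨T, hT⟩ := ih P Q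
    exact ⟨P * T, by simp [growth, hT]⟩
  | letLength x r p ih =>
    obtain ⟨T, hT⟩ := ih (P + Q) Q
    exact ⟨T, by simp [growth, hT]⟩

theorem exists_polynomial_cost (p : LoopProgram V R F) (P Q : Polynomial ℕ) :
    ∃ T : Polynomial ℕ, ∀ n, T.eval n = p.cost (P.eval n) (Q.eval n) := by
  induction p generalizing P Q with
  | load f => exact ⟨1, by simp [cost]⟩
  | push r g => exact ⟨1, by simp [cost]⟩
  | clear r => exact ⟨3 * Q + 2, by simp [cost]⟩
  | access r i f g => exact ⟨20 * Q + 20, by simp [cost]⟩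
  | seq p q ihp ihq =>
    obtain ⟨G, hG⟩ := p.exists_polynomial_growth P Q
    obtain ⟨T, hT⟩ := ihp P Q
    obtain ⟨U, hU⟩ := ihq P (Q + G)
    exact ⟨T + U, by simp [cost, hG, hT, hU]⟩
  | ite b p q ihp ihq =>
    obtain ⟨T, hT⟩ := ihp P Q
    obtain ⟨U, hU⟩ := ihq P Q
    exact ⟨T + U + 1, by simp [cost, hT, hU]⟩
  | forUpTo x v p ih =>
    obtain ⟨G, hG⟩ := p.exists_polynomial_growth P Q
    obtain ⟨T, hT⟩ := ih P (Q + P * G)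
    exact ⟨P * (T + 4) + 10 * P + 10, by simp [cost, hG, hT]⟩
  | letLength x r p ih =>
    obtain ⟨T, hT⟩ := ih (P + Q) Q
    exact ⟨T + 14 * Q + 3 * P + 10, by simp [cost, hT]⟩

/-- A problem is decidable in polynomial time if some loop program, started with the input in the
register `r` and with all other registers empty, ends with all registers empty and with the answer
in its memory. -/
theorem decidableInPolyTime [DecidableEq V] [DecidableEq R] [Fintype V] [Fintype R] [Fintype F]
    {α : Type} (enc : α → List Γ') (P : α → Prop) (p : LoopProgram V R F) (hp : p.WellFormed [])
    (r : R) (init : F) (out : F → Bool)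
    (h : ∀ a, ∃ f, p.run (fun _ => 0) (init, Function.update (fun _ => []) r (enc a)) =
      (f, fun _ => []) ∧ (out f = true ↔ P a)) :
    DecidableInPolyTime enc P := by
  classical
  -- Initially all variables are `0` and no register is longer than the input, hence the arguments
  -- `0` and `X`.
  obtain ⟨T, hT⟩ := p.exists_polynomial_cost 0 Polynomial.X
  have key : ∀ a w, w = enc a → Nonempty (Turing.TM2OutputsInTime
      (p.compile.toMachine (.inr (.inl r)) (init, none) fun s => out s.1) w
      (some [decide (P a)]) ((T + 1).eval (enc a).length)) := by
    rintro a w rfl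
    obtain ⟨f, hf, hout⟩ := h a
    obtain ⟨n, hn, he⟩ := exec_compile p [] hp (fun _ => 0)
      (init, Function.update (fun _ => []) r (enc a)) [] 0 (enc a).length (fun _ _ => rfl)
      (fun _ => le_rfl) (length_update_le (by simp) r le_rfl)
    have e₀ : store (unary fun _ : V => 0) (fun _ : R => []) [] [] = fun _ => [] := by
      funext k
      rcases k with k | k | k
      · rfl
      · rfl
      · cases k <;> rfl
    rw [hf] at he
    dsimp only at he
    rw [← update_store_reg, e₀] at he
    obtain ⟨o⟩ := toMachine_outputs p.compile (.inr (.inl r)) (init, none) (fun s => out s.1)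
      (enc a) (f, none) n he
    have hb : decide (P a) = out f := by
      by_cases hP : P a
      · simp [hP, hout.2 hP]
      · have : out f = false := by simpa using fun e => hP (hout.1 e)
        simp [hP, this]
    rw [hb]
    refine ⟨⟨o.toEvalsTo, o.steps_le_m.trans ?_⟩⟩
    simp only [Polynomial.eval_add, Polynomial.eval_one, hT, Polynomial.eval_zero,
      Polynomial.eval_X]
    omega
  exact ⟨{
    tm := p.compile.toMachine (.inr (.inl r)) (init, none) fun s => out s.1
    inputAlphabet := Equiv.refl Γ'
    outputAlphabet := Equiv.refl Bool
    time := T + 1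
    outputsFun := fun a => Classical.choice (key a _ (List.map_id _)) }⟩

end LoopProgram

/-! ### Orderings in which all members of a family of sets are intervals -/

/-- In an ordering in which all members of `𝓕` are intervals, two elements of a member `S` are on
the same side of any element outside `S`: the order of the pair `p` determines that of `q`. -/
def ForcingStep {C : Type} (𝓕 : Set (Set C)) (p q : C × C) : Prop :=
  ∃ S ∈ 𝓕, ∃ a ∈ S, ∃ b ∈ S, ∃ c ∉ S, (p = (a, c) ∧ q = (b, c)) ∨ (p = (c, a) ∧ q = (c, b))

/-- The order of the pair `p` determines that of `q` by a chain of forcing steps. -/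
def Linked {C : Type} (𝓕 : Set (Set C)) : C × C → C × C → Prop :=
  Relation.ReflTransGen (ForcingStep 𝓕)

section Linked

variable {C : Type} {𝓕 : Set (Set C)}

theorem ForcingStep.symm {p q : C × C} (h : ForcingStep 𝓕 p q) : ForcingStep 𝓕 q p := by
  obtain ⟨S, hS, a, ha, b, hb, c, hc, h⟩ := h
  exact ⟨S, hS, b, hb, a, ha, c, hc, h.imp (fun h => ⟨h.2, h.1⟩) fun h => ⟨h.2, h.1⟩⟩

theorem ForcingStep.swap {p q : C × C} (h : ForcingStep 𝓕 p q) :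
    ForcingStep 𝓕 p.swap q.swap := by
  obtain ⟨S, hS, a, ha, b, hb, c, hc, h⟩ := h
  refine ⟨S, hS, a, ha, b, hb, c, hc, ?_⟩
  rcases h with ⟨rfl, rfl⟩ | ⟨rfl, rfl⟩
  · exact .inr ⟨rfl, rfl⟩
  · exact .inl ⟨rfl, rfl⟩

theorem forcingStep_left {S : Set C} (hS : S ∈ 𝓕) {a b c : C} (ha : a ∈ S) (hb : b ∈ S)
    (hc : c ∉ S) : ForcingStep 𝓕 (a, c) (b, c) :=
  ⟨S, hS, a, ha, b, hb, c, hc, .inl ⟨rfl, rfl⟩⟩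

theorem forcingStep_right {S : Set C} (hS : S ∈ 𝓕) {a b c : C} (ha : a ∈ S) (hb : b ∈ S)
    (hc : c ∉ S) : ForcingStep 𝓕 (c, a) (c, b) :=
  ⟨S, hS, a, ha, b, hb, c, hc, .inr ⟨rfl, rfl⟩⟩

theorem Linked.symm {p q : C × C} (h : Linked 𝓕 p q) : Linked 𝓕 q p :=
  haveI : Std.Symm (ForcingStep 𝓕) := ⟨fun _ _ => ForcingStep.symm⟩
  (Relation.ReflTransGen.stdSymm).symm _ _ h

theorem Linked.trans {p q r : C × C} (h : Linked 𝓕 p q) (h' : Linked 𝓕 q r) : Linked 𝓕 p r :=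
  Relation.ReflTransGen.trans h h'

theorem Linked.swap {p q : C × C} (h : Linked 𝓕 p q) : Linked 𝓕 p.swap q.swap := by
  induction h with
  | refl => exact .refl
  | tail _ h ih => exact ih.tail h.swap

theorem Linked.ne {p q : C × C} (h : Linked 𝓕 p q) (hp : p.1 ≠ p.2) : q.1 ≠ q.2 := by
  induction h with
  | refl => exact hp
  | tail _ h _ =>
    obtain ⟨S, hS, a, ha, b, hb, c, hc, ⟨rfl, rfl⟩ | ⟨rfl, rfl⟩⟩ := h
    · exact fun (e : b = c) => hc (e ▸ hb)
    · exact fun (e : c = b) => hc (e.symm ▸ hb)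

/-- If `(b, c)` is linked neither to `(a, c)` nor to `(b, a)`, then `a` does not occur in the
pairs linked to `(b, c)`, and it is related to all of them in the same way. -/
theorem Linked.triangle {a b c : C} (h₁ : ¬ Linked 𝓕 (b, c) (a, c)) (h₂ : ¬ Linked 𝓕 (b, c) (b, a))
    {q : C × C} (h : Linked 𝓕 (b, c) q) :
    a ≠ q.1 ∧ a ≠ q.2 ∧ Linked 𝓕 (a, b) (a, q.1) ∧ Linked 𝓕 (a, c) (a, q.2) := by
  induction h with
  | refl =>
    refine ⟨?_, ?_, .refl, .refl⟩
    · rintro rfl; exact h₁ .refl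
    · rintro rfl; exact h₂ .refl
  | tail hq h ih =>
    obtain ⟨S, hS, x, hx, y, hy, z, hz, ⟨rfl, rfl⟩ | ⟨rfl, rfl⟩⟩ := h
    · obtain ⟨_, hne, l₁, l₂⟩ := ih
      -- If `a` were in `S`, the step could lead to `(a, z)` instead, and `(a, z)` is linked to `(a,
      -- c)`, which is excluded. With `a` outside `S`, the same set carries `(a, x)` to `(a, y)`.
      -- The other case is symmetric.
      have ha : a ∉ S := fun ha =>
        h₁ ((hq.tail (forcingStep_left hS hx ha hz)).trans l₂.symm)
      exact ⟨fun e => ha (e ▸ hy), hne, l₁.tail (forcingStep_right hS hx hy ha), l₂⟩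
    · obtain ⟨hne, _, l₁, l₂⟩ := ih
      have ha : a ∉ S := fun ha =>
        h₂ ((hq.tail (forcingStep_right hS hx ha hz)).trans l₁.symm.swap)
      exact ⟨hne, fun e => ha (e ▸ hy), l₁, l₂.tail (forcingStep_right hS hx hy ha)⟩

variable [LinearOrder C]

/-- `q` is linked to `p`, and it is the lexicographically least increasing pair linked to `p` or
to the reverse of `p`. -/
def IsLeastLinked (𝓕 : Set (Set C)) (p q : C × C) : Prop :=
  q.1 < q.2 ∧ Linked 𝓕 p q ∧
    ∀ r : C × C, r.1 < r.2 → Linked 𝓕 p r ∨ Linked 𝓕 p r.swap → toLex q ≤ toLex r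

/-- Orient each class of linked pairs so that its least increasing pair keeps its order. -/
def LexOriented (𝓕 : Set (Set C)) (p : C × C) : Prop := ∃ q, IsLeastLinked 𝓕 p q

theorem IsLeastLinked.congr {p p' q : C × C} (h : IsLeastLinked 𝓕 p q) (hp : Linked 𝓕 p p') :
    IsLeastLinked 𝓕 p' q :=
  ⟨h.1, hp.symm.trans h.2.1, fun r hr h' => h.2.2 r hr (h'.imp hp.trans hp.trans)⟩

theorem LexOriented.congr {p p' : C × C} (h : LexOriented 𝓕 p) (hp : Linked 𝓕 p p') :
    LexOriented 𝓕 p' :=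
  h.imp fun _ h => h.congr hp

/-- The least increasing pair in the union of the class of `p` and its reverse lies in one of the
two, and that one is oriented. -/
theorem lexOriented_or_swap [WellFoundedLT C] {p : C × C} (hp : p.1 ≠ p.2) :
    LexOriented 𝓕 p ∨ LexOriented 𝓕 p.swap := by
  have hne : {r : C ×ₗ C | (ofLex r).1 < (ofLex r).2 ∧
      (Linked 𝓕 p (ofLex r) ∨ Linked 𝓕 p (ofLex r).swap)}.Nonempty := by
    rcases lt_or_gt_of_ne hp with h | h
    · exact ⟨toLex p, h, .inl .refl⟩
    · exact ⟨toLex p.swap, h, .inr .refl⟩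
  obtain ⟨q, ⟨hq, hl⟩, hmin⟩ :=
    WellFounded.has_min (wellFounded_lt (α := C ×ₗ C)) _ hne
  have hle : ∀ r : C × C, r.1 < r.2 → Linked 𝓕 p r ∨ Linked 𝓕 p r.swap → q ≤ toLex r :=
    fun r hr h => not_lt.1 (hmin (toLex r) ⟨hr, h⟩)
  rcases hl with hl | hl
  · exact .inl ⟨ofLex q, hq, hl, hle⟩
  · exact .inr ⟨ofLex q, hq, hl.swap, fun r hr h => hle r hr (h.symm.imp Linked.swap Linked.swap)⟩

variable (h𝓕 : ∀ p : C × C, p.1 ≠ p.2 → ¬ Linked 𝓕 p p.swap)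

include h𝓕

/-- Both orientations minimise over the same set of increasing pairs, so they share the least pair,
which would link `p` to its reverse. -/
theorem LexOriented.not_swap {p : C × C} (h : LexOriented 𝓕 p) : ¬ LexOriented 𝓕 p.swap := by
  rintro ⟨q', hq'⟩
  obtain ⟨q, hq⟩ := h
  have e : toLex q = toLex q' := le_antisymm
    (hq.2.2 q' hq'.1 (.inr hq'.2.1.swap)) (hq'.2.2 q hq.1 (.inr hq.2.1.swap))
  obtain rfl : q = q' := e
  exact h𝓕 p (hq.2.1.symm.ne hq.1.ne) (hq.2.1.trans hq'.2.1.symm)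

theorem LexOriented.not_linked {p q : C × C} (hp : LexOriented 𝓕 p) (hq : LexOriented 𝓕 q.swap) :
    ¬ Linked 𝓕 p q :=
  fun h => (hp.congr h).not_swap h𝓕 hq

/-- In a 3-cycle the hypotheses of `Linked.triangle` hold for each side and the opposite vertex, so
a side can be replaced by any pair linked to it without destroying the cycle. Replace `(b, c)` by
the least pair `(b₀, c₀)` of its class. Comparison with the least pair `p` of the class of `(a, b)`
shows that `p` also begins with `b₀`, and a second use of the triangle lemma, with `c₀` opposite
`(a, b₀)`, then links two sides of the cycle in conflicting directions. -/
theorem LexOriented.not_cyclic_of_le {a b c : C} {p q : C × C} (hp : IsLeastLinked 𝓕 (a, b) p)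
    (hq : IsLeastLinked 𝓕 (b, c) q) (hca : LexOriented 𝓕 (c, a)) (hqp : toLex q ≤ toLex p) :
    False := by
  have hab : LexOriented 𝓕 (a, b) := ⟨p, hp⟩
  have hbc : LexOriented 𝓕 (b, c) := ⟨q, hq⟩
  obtain ⟨hne, -, l₁, l₂⟩ := Linked.triangle (hbc.not_linked h𝓕 (q := (a, c)) hca)
    (hbc.not_linked h𝓕 (q := (b, a)) hab) hq.2.1
  obtain ⟨b₀, c₀⟩ := q
  dsimp only at hne l₁ l₂
  have hp' := hp.congr l₁
  have hab' := hab.congr l₁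
  have hbc' := hbc.congr hq.2.1
  have hca' := hca.congr l₂.swap
  -- Otherwise `(a, b₀)` is increasing and in the class of `p`, so `(b₀, c₀) ≤ p ≤ (a, b₀)`
  -- lexicographically, which gives `b₀ ≤ a`.
  have hba : b₀ < a := by
    rcases lt_or_gt_of_ne hne with h | h
    · have := hqp.trans (hp'.2.2 (a, b₀) h (.inl .refl))
      rw [Prod.Lex.toLex_le_toLex] at this
      rcases this with h' | h'
      · exact absurd h' h.not_gt
      · exact absurd h'.1 h.ne'
    · exact h
  -- Now `(b₀, a)` is increasing and its reverse is in the class of `p`. Hence `(b₀, c₀) ≤ p ≤ (b₀,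
  -- a)`, and the first entries agree.
  have hpb : p.1 = b₀ := by
    have h := hp'.2.2 (b₀, a) hba (.inr .refl)
    rw [Prod.Lex.toLex_le_toLex] at h hqp
    refine le_antisymm ?_ ?_
    · rcases h with h | h
      · exact h.le
      · exact h.1.le
    · rcases hqp with h | h
      · exact h.le
      · exact h.1.le
  -- The link obtained is from `(c₀, a)` to `(c₀, p.1) = (c₀, b₀)`. But `(c₀, a)` is oriented as it
  -- stands and `(c₀, b₀)` in reverse.
  have l := (Linked.triangle (hab'.not_linked h𝓕 (q := (c₀, b₀)) hbc')
    (hab'.not_linked h𝓕 (q := (a, c₀)) hca') hp'.2.1).2.2.1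
  rw [hpb] at l
  exact hca'.not_linked h𝓕 (q := (c₀, b₀)) hbc' l

/-- Going round the cycle, the three least pairs cannot strictly increase at every step, so up to
rotation the previous lemma applies. -/
theorem LexOriented.not_cyclic {a b c : C} (hab : LexOriented 𝓕 (a, b))
    (hbc : LexOriented 𝓕 (b, c)) (hca : LexOriented 𝓕 (c, a)) : False := by
  obtain ⟨p, hp⟩ := id hab
  obtain ⟨q, hq⟩ := id hbc
  obtain ⟨r, hr⟩ := id hca
  rcases le_or_gt (toLex q) (toLex p) with h₁ | h₁
  · exact not_cyclic_of_le h𝓕 hp hq hca h₁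
  rcases le_or_gt (toLex r) (toLex q) with h₂ | h₂
  · exact not_cyclic_of_le h𝓕 hq hr hab h₂
  exact not_cyclic_of_le h𝓕 hr hp hbc (h₁.trans h₂).le

/-- If no pair of distinct elements is linked to its reverse, there is an ordering in which all
members of the family are intervals. -/
theorem exists_ordering_of_not_linked [WellFoundedLT C] :
    ∃ lt : C → C → Prop, IsStrictTotalOrder C lt ∧
      ∀ S ∈ 𝓕, ∀ a ∈ S, ∀ b ∈ S, ∀ c ∉ S, lt a c → lt b c := by
  have irrefl (a : C) : ¬ LexOriented 𝓕 (a, a) := fun h => h.not_swap h𝓕 h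
  refine ⟨fun a b => LexOriented 𝓕 (a, b), ?_, fun S hS a ha b hb c hc h =>
    h.congr (.single (forcingStep_left hS ha hb hc))⟩
  refine { trichotomous := ?_, irrefl := irrefl, trans := ?_ }
  · intro a b h₁ h₂
    by_contra hne
    exact (lexOriented_or_swap (p := (a, b)) hne).elim h₁ h₂
  · intro a b c hab hbc
    have hac : a ≠ c := by
      rintro rfl
      exact hab.not_swap h𝓕 hbc
    exact (lexOriented_or_swap (p := (a, c)) hac).resolve_right
      fun hca => LexOriented.not_cyclic h𝓕 hab hbc hca

end Linked

/-! ### Single-peakedness with outside options in terms of intervals -/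

namespace WeakOrder

variable {C : Type} {v : WeakOrder C} {a b c d : C}

/-- No candidate is worse than `a`. -/
def IsBottom (v : WeakOrder C) (a : C) : Prop := ∀ e, v.rel e a

/-- `p` is the unique most preferred candidate. -/
def IsTop (v : WeakOrder C) (p : C) : Prop := ∀ c, c ≠ p → v.Prefers p c

/-- The sets of candidates that are intervals of each axis with respect to which the vote is
single-peaked with outside options: for each `d` the candidates at least as good as `d`, and, if
`d` is not at the bottom, `d` together with the candidates better than `d`. -/
def intervals (v : WeakOrder C) : Set (Set C) :=
  {S | ∃ d, S = {x | v.rel x d} ∨ (∃ e, v.Prefers d e) ∧ S = {x | v.Prefers x d ∨ x = d}}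

theorem refl (v : WeakOrder C) (a : C) : v.rel a a := (v.complete a a).elim id id

theorem Prefers.rel (h : v.Prefers a b) : v.rel a b := h.1

theorem Prefers.trans_rel (h : v.Prefers a b) (h' : v.rel b c) : v.Prefers a c :=
  ⟨v.transitive _ _ _ h.1 h', fun h'' => h.2 (v.transitive _ _ _ h' h'')⟩

theorem Prefers.rel_trans (h' : v.rel a b) (h : v.Prefers b c) : v.Prefers a c :=
  ⟨v.transitive _ _ _ h' h.1, fun h'' => h.2 (v.transitive _ _ _ h'' h')⟩

theorem not_rel : ¬ v.rel a b ↔ v.Prefers b a :=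
  ⟨fun h => ⟨(v.complete a b).resolve_left h, h⟩, fun h => h.2⟩

theorem not_isBottom : ¬ v.IsBottom a ↔ ∃ e, v.Prefers a e := by
  simp only [IsBottom, not_forall, not_rel]

theorem Prefers.not_isBottom (h : v.Prefers a b) : ¬ v.IsBottom a := fun h' => h.2 (h' b)

instance : IsTrans C fun a b => v.Prefers a b := ⟨fun _ _ _ h h' => h.trans_rel h'.rel⟩

instance : IsTrans C fun a b => v.Prefers b a := ⟨fun _ _ _ h h' => h'.trans_rel h.rel⟩

/-- Candidate `c` is better than `a`, or both are at the bottom. -/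
def PrefersOrBottom (v : WeakOrder C) (c a : C) : Prop :=
  v.Prefers c a ∨ v.IsBottom c ∧ v.IsBottom a

/-- All these sets are closed under passing to better candidates. Those of the first kind are
everything as soon as they contain a bottom candidate; those of the second kind contain none, since
`d` is better than some `e`. -/
theorem PrefersOrBottom.mem {S : Set C} (hS : S ∈ v.intervals) (h : v.PrefersOrBottom c a)
    (ha : a ∈ S) : c ∈ S := by
  obtain ⟨d, rfl | ⟨⟨e, he⟩, rfl⟩⟩ := hS
  · rcases h with h | ⟨-, h⟩
    · exact v.transitive _ _ _ h.1 ha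
    · exact v.transitive _ _ _ (h c) ha
  · have had : v.rel a d := by
      rcases ha with ha | rfl
      · exact ha.1
      · exact v.refl _
    rcases h with h | ⟨-, h⟩
    · exact .inl (h.trans_rel had)
    · exact absurd h (Prefers.rel_trans had he).not_isBottom

/-- Everything after a candidate that is not at the bottom is strictly better than it, hence not at
the bottom either. So the bottom candidates form an initial segment, the future outside options. -/
theorem exists_split_of_pairwise (l : List C)
    (h : l.Pairwise fun a b => v.PrefersOrBottom b a) :
    ∃ O X, l = O ++ X ∧ (∀ a ∈ O, v.IsBottom a) ∧ (∀ a ∈ X, ¬ v.IsBottom a) ∧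
      X.Pairwise fun a b => v.Prefers b a := by
  induction l with
  | nil => exact ⟨[], [], by simp⟩
  | cons a l ih =>
    rw [List.pairwise_cons] at h
    by_cases ha : v.IsBottom a
    · obtain ⟨O, X, rfl, hO, hX, hX'⟩ := ih h.2
      exact ⟨a :: O, X, rfl, by simpa [ha] using hO, hX, hX'⟩
    · have h' : ∀ b ∈ l, v.Prefers b a := fun b hb =>
        (h.1 b hb).resolve_right fun h => ha h.2
      refine ⟨[], a :: l, rfl, by simp, ?_, ?_⟩
      · simpa [ha] using fun b hb => (h' b hb).not_isBottom
      · refine List.pairwise_cons.2 ⟨h', h.2.imp_of_mem fun {b c} hb _ hbc => ?_⟩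
        exact hbc.resolve_right fun h => (h' b hb).not_isBottom h.2

/-- On each side of the peak, a candidate `y` nearer to `p` than `x` must be better than `x` unless
both are at the bottom; otherwise some interval of the vote contains `x` and `p` but not `y` between
them. The split into segments then separates the bottom candidates on each side. -/
theorem isSinglePeakedWithOutsideOptions_of_ordering {lt : C → C → Prop}
    [IsStrictTotalOrder C lt] (L : Axis C) (hL : L.order.Pairwise lt) {p : C} (hp : v.IsTop p)
    (hlt : ∀ S ∈ v.intervals, ∀ a ∈ S, ∀ b ∈ S, ∀ c ∉ S, lt a c → lt b c) :
    v.IsSinglePeakedWithOutsideOptions L := by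
  have asymm {a b : C} (h : lt a b) (h' : lt b a) : False :=
    irrefl_of lt a (_root_.trans h h')
  have key {x y : C} (h : lt x y ∧ lt y p ∨ lt p y ∧ lt y x) : v.PrefersOrBottom y x := by
    have hxy : x ≠ y := by
      rintro rfl
      rcases h with h | h
      · exact irrefl_of lt x h.1
      · exact irrefl_of lt x h.2
    have hxp : x ≠ p := by
      rintro rfl
      exact h.elim (fun h => asymm h.1 h.2) fun h => asymm h.1 h.2
    have absurd_of {S : Set C} (hS : S ∈ v.intervals) (hx : x ∈ S) (hpS : p ∈ S) (hy : y ∉ S) :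
        False :=
      h.elim (fun h => asymm h.2 (hlt S hS x hx p hpS y hy h.1))
        fun h => asymm h.2 (hlt S hS p hpS x hx y hy h.1)
    by_contra hn
    simp only [PrefersOrBottom, not_or, not_and] at hn
    have hrel : v.rel x y := by
      by_contra h
      exact hn.1 (not_rel.1 h)
    -- If `x` and `y` are tied, the interval is `x` together with the candidates better than `x`,
    -- which is available because `x` is not at the bottom. If `x` is strictly better, it is the
    -- upper set of `x`.
    by_cases hyx : v.rel y x
    · have hbot : ¬ v.IsBottom x := fun hx =>
        hn.2 (fun e => v.transitive _ _ _ (hx e) hrel) hx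
      exact absurd_of (S := {z | v.Prefers z x ∨ z = x})
        ⟨x, .inr ⟨not_isBottom.1 hbot, rfl⟩⟩ (.inr rfl) (.inl (hp x hxp))
        fun h => h.elim hn.1 hxy.symm
    · exact absurd_of (S := {z | v.rel z x}) ⟨x, .inl rfl⟩ (v.refl x) (hp x hxp).1 hyx
  obtain ⟨l₁, l₂, hl⟩ := List.append_of_mem (L.complete p)
  rw [hl, List.pairwise_append, List.pairwise_cons] at hL
  obtain ⟨h₁, ⟨hp₂, h₂⟩, h₁₂⟩ := hL
  obtain ⟨O₁, X, rfl, hO₁, hX, hX'⟩ := exists_split_of_pairwise (v := v) l₁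
    (h₁.imp_of_mem fun _ hb h => key (.inl ⟨h, h₁₂ _ hb p (by simp)⟩))
  -- The right side is read from right to left, towards the peak, so that the same splitting lemma
  -- applies.
  obtain ⟨O₂, Z, hZ₀, hO₂, hZ, hZ'⟩ := exists_split_of_pairwise (v := v) l₂.reverse
    (List.pairwise_reverse.2 (h₂.imp_of_mem fun ha _ h => key (.inr ⟨hp₂ _ ha, h⟩)))
  obtain rfl : l₂ = Z.reverse ++ O₂.reverse := by
    rw [← List.reverse_append, ← hZ₀, List.reverse_reverse]
  have hO : ∀ b ∈ O₁ ++ O₂.reverse, v.IsBottom b := by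
    intro b hb
    rw [List.mem_append, List.mem_reverse] at hb
    exact hb.elim (hO₁ b) (hO₂ b)
  refine ⟨O₁, X, p, Z.reverse, O₂.reverse, by simp [hl], hp, ?_, ?_, ?_, ?_⟩
  · exact List.isChain_iff_pairwise.2 hX'
  · exact List.isChain_iff_pairwise.2 (List.pairwise_reverse.2 hZ')
  · intro a ha b hb
    simp only [List.mem_append, List.mem_singleton, List.mem_reverse] at ha
    have of_not {a : C} (ha : ¬ v.IsBottom a) : v.Prefers a b := by
      obtain ⟨e, he⟩ := not_isBottom.1 ha
      exact he.trans_rel (hO b hb e)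
    rcases ha with (ha | rfl) | ha
    · exact of_not (hX a ha)
    · refine hp b ?_
      rintro rfl
      have hn := L.nodup
      rw [hl] at hn
      simp only [List.mem_append, List.mem_reverse] at hb
      simp [List.nodup_append, List.nodup_cons] at hn
      grind
    · exact of_not (hZ a ha)
  · intro x hx y hy
    exact ⟨hO y hy x, hO x hx y⟩

theorem IsSinglePeakedWithOutsideOptions.exists_isTop {L : Axis C}
    (h : v.IsSinglePeakedWithOutsideOptions L) : ∃ p, v.IsTop p := by
  obtain ⟨_, _, p, _, _, _, h, _⟩ := h
  exact ⟨p, h⟩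

variable [DecidableEq C]

theorem of_pairwise_append_left {l₁ l₂ : List C} {r : C → C → Prop} (h : l₁.Pairwise r)
    (hb : b ∈ l₁) (hab : (l₁ ++ l₂).idxOf a < (l₁ ++ l₂).idxOf b) : r a b := by
  have hb' := List.idxOf_lt_length_of_mem hb
  rw [List.idxOf_append_of_mem hb] at hab
  have ha : a ∈ l₁ := by
    by_contra ha
    rw [List.idxOf_append_of_notMem ha] at hab
    omega
  rw [List.idxOf_append_of_mem ha] at hab
  have := List.pairwise_iff_getElem.1 h _ _ (List.idxOf_lt_length_of_mem ha) hb' hab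
  simpa using this

theorem of_pairwise_append_right {l₁ l₂ : List C} {r : C → C → Prop} (hn : (l₁ ++ l₂).Nodup)
    (h : l₂.Pairwise r) (ha : a ∈ l₂) (hb : b ∈ l₁ ++ l₂)
    (hab : (l₁ ++ l₂).idxOf a < (l₁ ++ l₂).idxOf b) : r a b := by
  have ha₁ : a ∉ l₁ := fun h => (List.disjoint_of_nodup_append hn) h ha
  rw [List.idxOf_append_of_notMem ha₁] at hab
  have hb₁ : b ∉ l₁ := by
    intro hb
    rw [List.idxOf_append_of_mem hb] at hab
    have := List.idxOf_lt_length_of_mem hb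
    omega
  have hb₂ : b ∈ l₂ := (List.mem_append.1 hb).resolve_left hb₁
  rw [List.idxOf_append_of_notMem hb₁] at hab
  have := List.pairwise_iff_getElem.1 h _ _ (List.idxOf_lt_length_of_mem ha)
    (List.idxOf_lt_length_of_mem hb₂) (by omega)
  simpa using this

/-- A candidate `c` strictly between `a` and `b` would belong to `S` by `PrefersOrBottom.mem`. Up to
the peak, moving right leads to better candidates or stays at the bottom, so there `c` is compared
with `a`; after the peak, `c` is compared with `b` on its right. -/
theorem IsSinglePeakedWithOutsideOptions.lt_of_lt {L : Axis C}
    (h : v.IsSinglePeakedWithOutsideOptions L) {S : Set C} (hS : S ∈ v.intervals) (ha : a ∈ S)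
    (hb : b ∈ S) (hc : c ∉ S) (hac : L.order.idxOf a < L.order.idxOf c) :
    L.order.idxOf b < L.order.idxOf c := by
  obtain ⟨O₁, X, p, Z, O₂, hL, hp, hX, hZ, hXO, hO⟩ := h
  have hX := List.isChain_iff_pairwise.1 hX
  have hZ := List.isChain_iff_pairwise.1 hZ
  -- Outside options are tied with each other and worse than everything else, so they are at the
  -- bottom.
  have hbot : ∀ x ∈ O₁ ++ O₂, v.IsBottom x := by
    intro x hx e
    have he := L.complete e
    rw [hL] at he
    simp only [List.mem_append, List.mem_singleton] at he hXO hO hx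
    by_cases heO : e ∈ O₁ ∨ e ∈ O₂
    · exact (hO e heO x hx).1
    · exact (hXO e (by tauto) x hx).1
  by_contra hbc
  have hbc : L.order.idxOf c < L.order.idxOf b := by
    refine lt_of_le_of_ne (not_lt.1 hbc) fun e => hc ?_
    rwa [(List.idxOf_inj (L.complete c)).1 e]
  have hn := L.nodup
  by_cases hcl : c ∈ O₁ ++ X ++ [p]
  · refine hc (PrefersOrBottom.mem hS (a := a) ?_ ha)
    have hl : (O₁ ++ X ++ [p]).Pairwise fun a c => v.PrefersOrBottom c a := by
      simp only [List.pairwise_append, List.pairwise_singleton, List.mem_append,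
        List.mem_singleton, List.append_assoc] at hXO hbot ⊢
      refine ⟨List.pairwise_of_forall_mem_list fun x hx y hy =>
          .inr ⟨hbot y (.inl hy), hbot x (.inl hx)⟩,
        ⟨hX.imp .inl, trivial, ?_⟩, ?_⟩
      · rintro x hx y rfl
        exact .inl (hp x (by rintro rfl; rw [hL] at hn; grind))
      · intro x hx y hy
        exact .inl (hXO y (by tauto) x (.inl hx))
    rw [hL, List.append_assoc _ Z O₂] at hac
    exact of_pairwise_append_left (r := fun a c => v.PrefersOrBottom c a) hl hcl hac
  · refine hc (PrefersOrBottom.mem hS (a := b) ?_ hb)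
    have hr : (Z ++ O₂).Pairwise fun c b => v.PrefersOrBottom c b := by
      simp only [List.pairwise_append, List.mem_append, List.append_assoc] at hXO hbot ⊢
      refine ⟨hZ.imp .inl, List.pairwise_of_forall_mem_list fun x hx y hy =>
          .inr ⟨hbot x (.inr hx), hbot y (.inr hy)⟩, ?_⟩
      intro x hx y hy
      exact .inl (hXO x (by tauto) y (.inr hy))
    rw [List.append_assoc _ Z O₂] at hL
    have hc' := L.complete c
    have hb' := L.complete b
    rw [hL] at hbc hc' hb' hn
    exact of_pairwise_append_right hn hr ((List.mem_append.1 hc').resolve_left hcl) hb' hbc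

end WeakOrder

theorem exists_axis_pairwise {C : Type} [Fintype C] (lt : C → C → Prop)
    [IsStrictTotalOrder C lt] : ∃ L : Axis C, L.order.Pairwise lt := by
  classical
  let _ : LinearOrder C := linearOrderOfSTO lt
  exact ⟨⟨Finset.univ.sort (· ≤ ·), Finset.sort_nodup _ _, by simp⟩,
    (Finset.sortedLT_sort (Finset.univ : Finset C)).pairwise⟩

/-- The sets of candidates that are intervals of each axis with respect to which the profile is
single-peaked with outside options. -/
def Profile.intervals (V : Profile) : Set (Set (Fin V.numCandidates)) :=
  {S | ∃ v ∈ V.votes, S ∈ v.intervals}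

/-- An axis fixes the direction of each pair, and linked pairs have the same direction, so a pair
linked to its reverse is impossible. Conversely the ordering built from the classes of linked pairs
is an axis. -/
theorem Profile.exists_axis_iff (V : Profile) :
    (∃ L : Axis (Fin V.numCandidates), V.IsSinglePeakedWithOutsideOptions L) ↔
      (∀ v ∈ V.votes, ∃ p, v.IsTop p) ∧
        ∀ q : Fin V.numCandidates × Fin V.numCandidates, q.1 ≠ q.2 →
          ¬ Linked V.intervals q q.swap := by
  constructor
  · rintro ⟨L, hL⟩
    refine ⟨fun v hv => (hL v hv).exists_isTop, fun q hq hl => ?_⟩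
    have lt_of_lt {S : Set (Fin V.numCandidates)} (hS : S ∈ V.intervals) {a b c}
        (ha : a ∈ S) (hb : b ∈ S) (hc : c ∉ S) :
        L.order.idxOf a < L.order.idxOf c → L.order.idxOf b < L.order.idxOf c := by
      obtain ⟨v, hv, hS⟩ := hS
      exact (hL v hv).lt_of_lt hS ha hb hc
    have inj {a b : Fin V.numCandidates} (h : L.order.idxOf a = L.order.idxOf b) : a = b :=
      (List.idxOf_inj (L.complete a)).1 h
    have key : ∀ q r : Fin V.numCandidates × Fin V.numCandidates, Linked V.intervals q r →
        L.order.idxOf q.1 < L.order.idxOf q.2 → L.order.idxOf r.1 < L.order.idxOf r.2 := by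
      intro q r h hq
      induction h with
      | refl => exact hq
      | tail _ h ih =>
        obtain ⟨S, hS, a, ha, b, hb, c, hc, ⟨rfl, rfl⟩ | ⟨rfl, rfl⟩⟩ := h
        · exact lt_of_lt hS ha hb hc ih
        · by_contra h
          have hne : b ≠ c := fun e => hc (e ▸ hb)
          have hbc : L.order.idxOf b < L.order.idxOf c :=
            lt_of_le_of_ne (not_lt.1 h) fun e => hne (inj e)
          have := lt_of_lt hS hb ha hc hbc
          dsimp only at ih
          omega
    rcases lt_or_gt_of_ne fun e => hq (inj e) with h | h
    · exact h.not_gt (key q q.swap hl h)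
    · exact h.not_gt (key q.swap q hl.symm h)
  · rintro ⟨htop, hlink⟩
    obtain ⟨lt, hlt, h⟩ := exists_ordering_of_not_linked hlink
    obtain ⟨L, hL⟩ := exists_axis_pairwise lt
    refine ⟨L, fun v hv => ?_⟩
    obtain ⟨p, hp⟩ := htop v hv
    exact WeakOrder.isSinglePeakedWithOutsideOptions_of_ordering L hL hp
      fun S hS => h S ⟨v, hv, hS⟩

/-! ### The decision program: registers, arithmetic on positions, and tests -/

namespace OutsideOptions

open Computability (Γ')

/-- The variables of the decision program. -/
inductive Var
  | n | m | m₁ | q | t | e | a | b | c | r | s | s' | i | j | k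
  deriving DecidableEq

instance : Fintype Var :=
  ⟨{.n, .m, .m₁, .q, .t, .e, .a, .b, .c, .r, .s, .s', .i, .j, .k}, by rintro ⟨⟩ <;> decide⟩

/-- The registers of the decision program. -/
inductive Reg
  | input | size | index | mark | reach
  deriving DecidableEq

instance : Fintype Reg :=
  ⟨{.input, .size, .index, .mark, .reach}, by rintro ⟨⟩ <;> decide⟩

/-- The memory of the decision program. -/
structure Memory where
  bit : Bool
  ok : Bool
  found : Bool
  good : Bool
  deriving Fintype

/-- Programs over these variables, registers and memory. -/
abbrev Program := LoopProgram Var Reg Memory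

/-- The contents of the registers. -/
def regs (w u : List Γ') (n : ℕ) (k X : List Γ') : Reg → List Γ'
  | .input => w
  | .size => u
  | .index => List.replicate n (.bit true)
  | .mark => k
  | .reach => X

section regs

variable (w u : List Γ') (n : ℕ) (k X l : List Γ')

@[simp] theorem regs_input : regs w u n k X .input = w := rfl
@[simp] theorem regs_size : regs w u n k X .size = u := rfl
@[simp] theorem regs_index : regs w u n k X .index = List.replicate n (.bit true) := rfl
@[simp] theorem regs_mark : regs w u n k X .mark = k := rfl
@[simp] theorem regs_reach : regs w u n k X .reach = X := rfl

@[simp] theorem update_input : Function.update (regs w u n k X) .input l = regs l u n k X := by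
  funext r; cases r <;> rfl

@[simp] theorem update_size : Function.update (regs w u n k X) .size l = regs w l n k X := by
  funext r; cases r <;> rfl

@[simp] theorem update_index_cons :
    Function.update (regs w u n k X) .index (.bit true :: List.replicate n (.bit true)) =
      regs w u (n + 1) k X := by
  funext r; cases r <;> rfl

@[simp] theorem update_index_nil :
    Function.update (regs w u n k X) .index [] = regs w u 0 k X := by
  funext r; cases r <;> rfl

@[simp] theorem update_mark : Function.update (regs w u n k X) .mark l = regs w u n l X := by
  funext r; cases r <;> rfl

@[simp] theorem update_reach : Function.update (regs w u n k X) .reach l = regs w u n k l := by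
  funext r; cases r <;> rfl

end regs

theorem foldl_range_eq {σ : Type} (f : σ → ℕ → σ) (S : ℕ → σ) (n : ℕ)
    (h : ∀ i < n, f (S i) i = S (i + 1)) : (List.range n).foldl f (S 0) = S n := by
  induction n with
  | zero => rfl
  | succ n ih =>
    rw [List.range_succ, List.foldl_append, ih fun i hi => h i (by omega)]
    exact h n (by omega)

theorem modify_self {α : Type} (l : List α) (n : ℕ) : (l.modify n fun d => d) = l :=
  List.modify_id n l

/-- Do nothing. -/
def skip : Program := .load id

theorem run_forUpTo (p : Program) (env : Var → ℕ) (x v : Var) (S : ℕ → Memory × (Reg → List Γ'))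
    (h : ∀ i < env v, p.run (Function.update env x i) (S i) = S (i + 1)) :
    (LoopProgram.forUpTo x v p).run env (S 0) = S (env v) :=
  foldl_range_eq _ S _ h

/-- Increase the index by one. -/
def tick : Program := .push .index fun _ => .bit true

/-- Add the variable `v` to the index. -/
def addVar (v : Var) : Program := .forUpTo .i v tick

/-- Add the product of the variables `v` and `v'` to the index. -/
def addMul (v v' : Var) : Program := .forUpTo .j v (addVar v')

/-- Reset the auxiliary bit. -/
def resetBit : Program := .load fun f => { f with bit := false }

/-- Run `p` if the symbol `c` stands at the current index of the register `x`, and `p'` otherwise.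
The index is reset. -/
def test (x : Reg) (c : Γ') (p p' : Program) : Program :=
  .seq (.access x .index (fun f o => { f with bit := decide (o = some c) }) fun _ d => d) <|
  .seq (.clear .index) <| .ite Memory.bit (.seq resetBit p) (.seq resetBit p')

/-- Run `p` if the variables `v` and `v'` are equal, and `p'` otherwise. -/
def ifEq (v v' : Var) (p p' : Program) : Program :=
  .seq (.push .mark fun _ => .bit true) <|
  .seq (.forUpTo .i v (.push .mark fun _ => .bit false)) <|
  .seq (addVar v') <|
  .seq (.access .mark .index (fun f o => { f with bit := decide (o = some (.bit true)) })
    fun _ d => d) <|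
  .seq (.clear .index) <|
  .seq (.clear .mark) <| .ite Memory.bit (.seq resetBit p) (.seq resetBit p')

/-- Add to the index the position at which the encoding of the vote number `t` begins. -/
def addVote : Program :=
  .seq (addVar .m₁) (.forUpTo .k .t (.seq (addMul .m .m₁) (.seq tick tick)))

/-- Run `p` if the vote number `t` exists, and `p'` otherwise. -/
def ifVote (p p' : Program) : Program := .seq addVote (test .input .bra p p')

/-- Run `p` if `v` is at least as good as `v'` in the vote number `t`, and `p'` otherwise. -/
def ifRel (v v' : Var) (p p' : Program) : Program :=
  .seq addVote <| .seq tick <| .seq (addMul v .m₁) <| .seq (addVar v') <|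
    test .input (.bit true) p p'

/-- Write `1` at the current index of the register `reach` and reset the index. -/
def setReach : Program :=
  .seq (.access .reach .index (fun f _ => f) fun _ _ => .bit true) (.clear .index)

/-- If the pair `(v, v')` has been reached, then so is `(z, z')`. -/
def propagate (v v' z z' : Var) : Program :=
  .seq (addMul v .m) <| .seq (addVar v') <|
    test .reach (.bit true) (.seq (addMul z .m) (.seq (addVar z') setReach)) skip

section macros

variable (env : Var → ℕ) (f : Memory) (w u : List Γ') (n : ℕ) (k X : List Γ')

@[simp] theorem run_skip (s : Memory × (Reg → List Γ')) : skip.run env s = s := rfl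

@[simp] theorem run_tick : tick.run env (f, regs w u n k X) = (f, regs w u (n + 1) k X) := by
  simp [tick, LoopProgram.run]

@[simp] theorem run_addVar (v : Var) :
    (addVar v).run env (f, regs w u n k X) = (f, regs w u (n + env v) k X) :=
  run_forUpTo tick env .i v (fun i => (f, regs w u (n + i) k X)) fun i _ => by
    simp [Nat.add_assoc]

@[simp] theorem run_addMul (v v' : Var) (hv' : v' ≠ .j) :
    (addMul v v').run env (f, regs w u n k X) = (f, regs w u (n + env v * env v') k X) := by
  have := run_forUpTo (addVar v') env .j v (fun i => (f, regs w u (n + i * env v') k X)) fun i _ => by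
    simp [hv', Nat.add_assoc, Nat.succ_mul]
  rwa [Nat.zero_mul, Nat.add_zero] at this

/-- The bit is reset at the start of either branch. If it was clear before the test, the memory is
therefore unchanged, and tests can be nested. -/
theorem run_test (x : Reg) (c : Γ') (p p' : Program) (hf : f.bit = false) :
    (test x c p p').run env (f, regs w u n k X) =
      if (regs w u n k X x)[n]? = some c then p.run env (f, regs w u 0 k X)
      else p'.run env (f, regs w u 0 k X) := by
  obtain ⟨bit, ok, found, good⟩ := f
  obtain rfl : bit = false := hf
  by_cases h : (regs w u n k X x)[n]? = some c
  · simp [test, LoopProgram.run, resetBit, h, modify_self]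
  · simp [test, LoopProgram.run, resetBit, h, modify_self]

theorem getElem?_replicate_append_eq_some_iff (a b : ℕ) :
    (List.replicate a (Γ'.bit false) ++ [.bit true])[b]? = some (.bit true) ↔ a = b := by
  rw [List.getElem?_append]
  split_ifs with h
  · simp only [List.length_replicate] at h
    simp [h, h.ne']
  · simp only [List.length_replicate] at h
    rw [List.length_replicate]
    rcases e : b - a with _ | d
    · have : a = b := by omega
      simpa using this
    · have : a ≠ b := by omega
      simpa using this

/-- The register `mark` is filled with `env v` zeros followed by a single `1`, so position `env v'`
holds `1` exactly if the two values agree. -/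
theorem run_ifEq (v v' : Var) (p p' : Program) (hf : f.bit = false) :
    (ifEq v v' p p').run env (f, regs w u 0 [] X) =
      if env v = env v' then p.run env (f, regs w u 0 [] X)
      else p'.run env (f, regs w u 0 [] X) := by
  obtain ⟨bit, ok, found, good⟩ := f
  obtain rfl : bit = false := hf
  have h₁ := run_forUpTo (.push Reg.mark fun _ => .bit false) env .i v
    (fun i => (Memory.mk false ok found good,
      regs w u 0 (List.replicate i (.bit false) ++ [.bit true]) X)) fun i _ => by
        simp [LoopProgram.run, List.replicate_succ]
  rw [List.replicate_zero, List.nil_append] at h₁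
  unfold ifEq
  -- `run.eq_5` is the clause of `run` for `seq`. Unfolding nothing else keeps the macros intact for
  -- their own lemmas.
  simp only [LoopProgram.run.eq_5]
  rw [show (LoopProgram.push Reg.mark fun _ => Γ'.bit true).run env
      (Memory.mk false ok found good, regs w u 0 [] X) =
        (Memory.mk false ok found good, regs w u 0 [.bit true] X) by simp [LoopProgram.run], h₁,
    run_addVar]
  simp only [LoopProgram.run, regs_mark, regs_index, List.length_replicate, Nat.zero_add,
    modify_self, update_mark, update_index_nil, getElem?_replicate_append_eq_some_iff]
  by_cases h : env v = env v'
  · simp [LoopProgram.run, resetBit, h]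
  · simp [LoopProgram.run, resetBit, h]

end macros

end OutsideOptions

/-! ### Reading votes from the input and passing marks between pairs -/

namespace OutsideOptions

open Computability (Γ')

/-- In the string `w`, the encoding of the vote number `t` begins at the expected position, if the
number of candidates is `m`. -/
def VoteAt (w : List Γ') (m t : ℕ) : Prop :=
  w[m + 1 + t * (m * (m + 1) + 2)]? = some .bra

/-- In the string `w`, `a` is at least as good as `b` in the vote number `t`, if the number of
candidates is `m`. -/
def RelAt (w : List Γ') (m t a b : ℕ) : Prop :=
  w[m + 1 + t * (m * (m + 1) + 2) + 1 + a * (m + 1) + b]? = some (.bit true)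

instance (w : List Γ') (m t : ℕ) : Decidable (VoteAt w m t) :=
  inferInstanceAs (Decidable (_ = _))

instance (w : List Γ') (m t a b : ℕ) : Decidable (RelAt w m t a b) :=
  inferInstanceAs (Decidable (_ = _))

section queries

variable (env : Var → ℕ) (hm : env .m₁ = env .m + 1) (f : Memory) (w u : List Γ') (n : ℕ)
  (k X : List Γ')

include hm

theorem run_addVote :
    addVote.run env (f, regs w u n k X) =
      (f, regs w u (n + (env .m + 1 + env .t * (env .m * (env .m + 1) + 2))) k X) := by
  have h := run_forUpTo (.seq (addMul .m .m₁) (.seq tick tick)) env .k .t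
    (fun i => (f, regs w u (n + (env .m + 1) + i * (env .m * (env .m + 1) + 2)) k X)) fun i _ => by
      simp only [LoopProgram.run, ne_eq, reduceCtorEq, not_false_eq_true, run_addMul, run_tick,
        Function.update_of_ne, hm]
      congr 2
      ring
  rw [Nat.zero_mul, Nat.add_zero] at h
  rw [addVote, LoopProgram.run.eq_5, run_addVar, hm, h, Nat.add_assoc]

theorem run_ifVote (p p' : Program) (hf : f.bit = false) :
    (ifVote p p').run env (f, regs w u 0 k X) =
      if VoteAt w (env .m) (env .t) then p.run env (f, regs w u 0 k X)
      else p'.run env (f, regs w u 0 k X) := by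
  rw [ifVote, LoopProgram.run.eq_5, run_addVote env hm, run_test _ _ _ _ _ _ _ _ _ _ _ hf,
    Nat.zero_add]
  rfl

theorem run_ifRel (v v' : Var) (p p' : Program) (hf : f.bit = false) :
    (ifRel v v' p p').run env (f, regs w u 0 k X) =
      if RelAt w (env .m) (env .t) (env v) (env v') then p.run env (f, regs w u 0 k X)
      else p'.run env (f, regs w u 0 k X) := by
  simp only [ifRel, LoopProgram.run.eq_5]
  rw [run_addVote env hm, run_tick, run_addMul _ _ _ _ _ _ _ _ _ (by simp), run_addVar,
    run_test _ _ _ _ _ _ _ _ _ _ _ hf, Nat.zero_add, hm]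
  rfl

end queries

/-- Mark position `j` if position `i` is marked. -/
def mark (X : List Γ') (i j : ℕ) : List Γ' :=
  if X[i]? = some (.bit true) then X.modify j fun _ => .bit true else X

theorem run_setReach (env : Var → ℕ) (f : Memory) (w u : List Γ') (n : ℕ) (k X : List Γ') :
    setReach.run env (f, regs w u n k X) =
      (f, regs w u 0 k (X.modify n fun _ => .bit true)) := by
  simp [setReach, LoopProgram.run]

theorem run_propagate (env : Var → ℕ) (f : Memory) (hf : f.bit = false) (w u k X : List Γ')
    (v v' z z' : Var) : (propagate v v' z z').run env (f, regs w u 0 k X) =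
      (f, regs w u 0 k
        (mark X (env v * env .m + env v') (env z * env .m + env z'))) := by
  simp only [propagate, LoopProgram.run.eq_5]
  rw [run_addMul _ _ _ _ _ _ _ _ _ (by simp), run_addVar, run_test _ _ _ _ _ _ _ _ _ _ _ hf,
    mark]
  simp only [regs_reach, Nat.zero_add]
  split_ifs
  · rw [LoopProgram.run.eq_5, LoopProgram.run.eq_5, run_addMul _ _ _ _ _ _ _ _ _ (by simp),
      run_addVar, run_setReach, Nat.zero_add]
  · rw [run_skip]

/-- The marked positions. -/
def marked (X : List Γ') : Set ℕ := {i | X[i]? = some (.bit true)}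

/-- `Y` arises from `X` by marking positions. Along each edge in `T` a mark has been passed on at
least once, and marks have been passed on along edges in `T` only. -/
structure Spread (T : ℕ → ℕ → Prop) (X Y : List Γ') : Prop where
  length_eq : Y.length = X.length
  subset : marked X ⊆ marked Y
  closed : ∀ i j, T i j → i ∈ marked X → j < X.length → j ∈ marked Y
  sound : ∀ A : Set ℕ, marked X ⊆ A → (∀ i j, T i j → i ∈ A → j ∈ A) → marked Y ⊆ A

namespace Spread

variable {T T' : ℕ → ℕ → Prop} {X Y Z : List Γ'}

theorem refl (X : List Γ') : Spread (fun _ _ => False) X X :=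
  ⟨rfl, subset_rfl, fun _ _ h => h.elim, fun _ h _ => h⟩

theorem trans (h : Spread T X Y) (h' : Spread T' Y Z) :
    Spread (fun i j => T i j ∨ T' i j) X Z where
  length_eq := h'.length_eq.trans h.length_eq
  subset := h.subset.trans h'.subset
  closed i j hij hi hj := by
    rcases hij with hij | hij
    · exact h'.subset (h.closed i j hij hi hj)
    · exact h'.closed i j hij (h.subset hi) (h.length_eq ▸ hj)
  sound A hA hT := h'.sound A (h.sound A hA fun i j hij => hT i j (.inl hij))
    fun i j hij => hT i j (.inr hij)

theorem congr (h : Spread T X Y) (hT : ∀ i j, T i j ↔ T' i j) : Spread T' X Y := by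
  obtain rfl : T = T' := by funext i j; exact propext (hT i j)
  exact h

theorem mark (X : List Γ') (i j : ℕ) : Spread (fun i' j' => i' = i ∧ j' = j) X (mark X i j) := by
  unfold OutsideOptions.mark
  split_ifs with h
  · refine ⟨by simp, ?_, ?_, ?_⟩
    · intro l hl
      simp only [marked, Set.mem_ofPred_eq, List.getElem?_modify] at hl ⊢
      rw [hl]
      simp
    · rintro _ _ ⟨rfl, rfl⟩ - hj
      simp [marked, List.getElem?_modify, hj]
    · intro A hA hT l hl
      simp only [marked, Set.mem_ofPred_eq, List.getElem?_modify] at hl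
      by_cases hjl : j = l
      · subst hjl
        exact hT i j ⟨rfl, rfl⟩ (hA h)
      · exact hA (by simpa [marked, hjl] using hl)
  · refine ⟨rfl, subset_rfl, ?_, fun A hA _ => hA⟩
    rintro _ _ ⟨rfl, rfl⟩ hi
    exact absurd hi h

/-- Passing marks along all edges as often as there are positions marks everything that can be
reached. -/
theorem marked_eq_of_iterate {T : ℕ → ℕ → Prop} (S : ℕ → List Γ') (L i₀ : ℕ)
    (hL : (S 0).length = L) (h₀ : marked (S 0) = {i₀}) (hT : ∀ i j, T i j → j < L)
    (h : ∀ n, Spread T (S n) (S (n + 1))) :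
    marked (S L) = {j | Relation.ReflTransGen T i₀ j} := by
  have hlen : ∀ n, (S n).length = L := fun n => by
    induction n with
    | zero => exact hL
    | succ n ih => rw [(h n).length_eq, ih]
  have hsub : ∀ n, marked (S n) ⊆ Set.Iio L := fun n i hi => by
    obtain ⟨hlt, -⟩ := List.getElem?_eq_some_iff.1 hi
    exact hlen n ▸ hlt
  have hfin : ∀ n, (marked (S n)).Finite := fun n => (Set.finite_Iio L).subset (hsub n)
  have hsound : ∀ n, marked (S n) ⊆ {j | Relation.ReflTransGen T i₀ j} := fun n => by
    induction n with
    | zero => rw [h₀]; rintro _ rfl; exact .refl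
    | succ n ih => exact (h n).sound _ ih fun i j hij hi => .tail hi hij
  have hmem : ∀ n, i₀ ∈ marked (S n) := fun n => by
    induction n with
    | zero => rw [h₀]; rfl
    | succ n ih => exact (h n).subset ih
  -- As long as the set of marks is not closed, every round adds a new one. Within a round marks may
  -- travel along several edges, so the number of marks is only bounded from below.
  have hgrow : ∀ n, (∀ i j, T i j → i ∈ marked (S n) → j ∈ marked (S n)) ∨
      n + 1 ≤ (marked (S n)).ncard := fun n => by
    induction n with
    | zero => right; rw [h₀]; simp
    | succ n ih =>
      by_cases hc : ∀ i j, T i j → i ∈ marked (S n) → j ∈ marked (S n)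
      · left
        have e : marked (S (n + 1)) = marked (S n) :=
          Set.Subset.antisymm ((h n).sound _ subset_rfl hc) (h n).subset
        rwa [e]
      · right
        have hn := ih.resolve_left hc
        push Not at hc
        obtain ⟨i, j, hij, hi, hj⟩ := hc
        have hlt : (marked (S n)).ncard < (marked (S (n + 1))).ncard := by
          refine Set.ncard_lt_ncard ((Set.ssubset_iff_of_subset (h n).subset).2
            ⟨j, (h n).closed i j hij hi ?_, hj⟩) (hfin _)
          rw [hlen]
          exact hT i j hij
        omega
  refine Set.Subset.antisymm (hsound L) fun j hj => ?_
  -- There is no room for `L + 1` marks among `L` positions.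
  have hclosed := (hgrow L).resolve_right fun hle => by
    have := Set.ncard_le_ncard (hsub L) (Set.finite_Iio L)
    simp only [Set.ncard_Iio_nat] at this
    omega
  induction hj with
  | refl => exact hmem L
  | tail _ hij ih => exact hclosed _ _ hij ih

end Spread

/-- In all states with the memory `f` and the input `w`, the program `p` passes marks along the
edges in `T`. -/
def Spreads (f : Memory) (w : List Γ') (p : Program) (env : Var → ℕ) (T : ℕ → ℕ → Prop) : Prop :=
  ∀ X, ∃ Y, p.run env (f, regs w [] 0 [] X) = (f, regs w [] 0 [] Y) ∧ Spread T X Y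

namespace Spreads

variable {f : Memory} {w : List Γ'} {p p' : Program} {env : Var → ℕ} {T T' : ℕ → ℕ → Prop}

theorem congr (h : Spreads f w p env T) (hT : ∀ i j, T i j ↔ T' i j) : Spreads f w p env T' :=
  fun X => (h X).imp fun _ h => ⟨h.1, h.2.congr hT⟩

theorem skip : Spreads f w skip env fun _ _ => False := fun X => ⟨X, rfl, .refl X⟩

theorem seq (h : Spreads f w p env T) (h' : Spreads f w p' env T') :
    Spreads f w (.seq p p') env fun i j => T i j ∨ T' i j := by
  intro X
  obtain ⟨Y, hY, hXY⟩ := h X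
  obtain ⟨Z, hZ, hYZ⟩ := h' Y
  exact ⟨Z, by rw [LoopProgram.run.eq_5, hY, hZ], hXY.trans hYZ⟩

theorem propagate (hf : f.bit = false) (v v' z z' : Var) :
    Spreads f w (propagate v v' z z') env fun i j =>
      i = env v * env .m + env v' ∧ j = env z * env .m + env z' :=
  fun X => ⟨_, run_propagate env f hf w [] [] X v v' z z', .mark X _ _⟩

theorem ifRel (hf : f.bit = false) (hm : env .m₁ = env .m + 1) (v v' : Var)
    (h : Spreads f w p env T) (h' : Spreads f w p' env T') :
    Spreads f w (ifRel v v' p p') env fun i j =>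
      RelAt w (env .m) (env .t) (env v) (env v') ∧ T i j ∨
        ¬ RelAt w (env .m) (env .t) (env v) (env v') ∧ T' i j := by
  intro X
  rw [run_ifRel env hm f w [] [] X v v' p p' hf]
  split_ifs with hr
  · exact h.congr (fun i j => by simp [hr]) X
  · exact h'.congr (fun i j => by simp [hr]) X

theorem ifEq (hf : f.bit = false) (v v' : Var) (h : Spreads f w p env T)
    (h' : Spreads f w p' env T') :
    Spreads f w (ifEq v v' p p') env fun i j =>
      env v = env v' ∧ T i j ∨ env v ≠ env v' ∧ T' i j := by
  intro X
  rw [run_ifEq env f w [] X v v' p p' hf]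
  split_ifs with hr
  · exact h.congr (fun i j => by simp [hr]) X
  · exact h'.congr (fun i j => by simp [hr]) X

theorem forUpTo (x v : Var) {T : ℕ → ℕ → ℕ → Prop}
    (h : ∀ l < env v, Spreads f w p (Function.update env x l) (T l)) :
    Spreads f w (.forUpTo x v p) env fun i j => ∃ l < env v, T l i j := by
  intro X
  have key : ∀ n ≤ env v, ∃ Y, (List.range n).foldl
      (fun s i => p.run (Function.update env x i) s) (f, regs w [] 0 [] X) =
        (f, regs w [] 0 [] Y) ∧ Spread (fun i j => ∃ l < n, T l i j) X Y := by
    intro n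
    induction n with
    | zero => exact fun _ => ⟨X, rfl, (Spread.refl X).congr (by simp)⟩
    | succ n ih =>
      intro hn
      obtain ⟨Y, hY, hXY⟩ := ih (by omega)
      obtain ⟨Z, hZ, hYZ⟩ := h n hn Y
      refine ⟨Z, by rw [LoopProgram.run_forUpTo_succ, hY, hZ], (hXY.trans hYZ).congr ?_⟩
      intro i j
      constructor
      · rintro (⟨l, hl, h⟩ | h)
        · exact ⟨l, by omega, h⟩
        · exact ⟨n, by omega, h⟩
      · rintro ⟨l, hl, h⟩
        rcases Nat.lt_succ_iff_lt_or_eq.1 hl with hl | rfl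
        · exact .inl ⟨l, hl, h⟩
        · exact .inr h
  exact key _ le_rfl

end Spreads

/-- Pass marks in both directions along the edges between the pairs `(a, c)` and `(b, c)` and
between `(c, a)` and `(c, b)`. -/
def spread : Program :=
  .seq (propagate .a .c .b .c) <| .seq (propagate .b .c .a .c) <|
    .seq (propagate .c .a .c .b) (propagate .c .b .c .a)

/-- Pass marks if `a` and `b` are better than `c`. -/
def spreadLower : Program :=
  ifRel .a .c (ifRel .c .a skip (ifRel .b .c (ifRel .c .b skip spread) skip)) skip

/-- Pass marks if `b` is better than `a`, and `a` is tied with `c ≠ a` and better than `e`. -/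
def spreadTie : Program :=
  ifRel .b .a (ifRel .a .b skip (ifRel .c .a (ifRel .a .c (ifEq .c .a skip
    (ifRel .a .e (ifRel .e .a skip spread) skip)) skip) skip)) skip

/-- Pass marks along all edges. -/
def round : Program :=
  .forUpTo .t .n <| .forUpTo .a .m <| .forUpTo .b .m <| .forUpTo .c .m <| .forUpTo .e .m <|
    .seq spreadLower spreadTie

/-- The candidate `c` is separated from `a` and `b` by an interval of the vote number `t`. -/
def Separates (w : List Γ') (m t e a b c : ℕ) : Prop :=
  (RelAt w m t a c ∧ ¬ RelAt w m t c a ∧ RelAt w m t b c ∧ ¬ RelAt w m t c b) ∨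
    (RelAt w m t b a ∧ ¬ RelAt w m t a b ∧ RelAt w m t c a ∧ RelAt w m t a c ∧ c ≠ a ∧
      RelAt w m t a e ∧ ¬ RelAt w m t e a)

/-- The edges between the pairs `(a, c)` and `(b, c)` and between `(c, a)` and `(c, b)`, where the
pair `(x, y)` is represented by the number `x * m + y`. -/
def PairEdge (m a b c i j : ℕ) : Prop :=
  (i = a * m + c ∧ j = b * m + c) ∨ (i = b * m + c ∧ j = a * m + c) ∨
    (i = c * m + a ∧ j = c * m + b) ∨ (i = c * m + b ∧ j = c * m + a)

/-- The edges along which `round` passes marks. -/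
def Edge (w : List Γ') (n m i j : ℕ) : Prop :=
  ∃ t < n, ∃ a < m, ∃ b < m, ∃ c < m, ∃ e < m, Separates w m t e a b c ∧ PairEdge m a b c i j

theorem spreads_spread {f : Memory} (hf : f.bit = false) (w : List Γ') (env : Var → ℕ) :
    Spreads f w spread env (PairEdge (env .m) (env .a) (env .b) (env .c)) :=
  (((Spreads.propagate hf _ _ _ _).seq <| (Spreads.propagate hf _ _ _ _).seq <|
    (Spreads.propagate hf _ _ _ _).seq (Spreads.propagate hf _ _ _ _))).congr fun _ _ => Iff.rfl

theorem spreads_body {f : Memory} (hf : f.bit = false) (w : List Γ') (env : Var → ℕ)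
    (hm : env .m₁ = env .m + 1) :
    Spreads f w (.seq spreadLower spreadTie) env fun i j =>
      Separates w (env .m) (env .t) (env .e) (env .a) (env .b) (env .c) ∧
        PairEdge (env .m) (env .a) (env .b) (env .c) i j := by
  have h := spreads_spread hf w env
  have h₁ : Spreads f w spreadLower env _ :=
    .ifRel hf hm _ _ (.ifRel hf hm _ _ .skip (.ifRel hf hm _ _ (.ifRel hf hm _ _ .skip h) .skip))
      .skip
  have h₂ : Spreads f w spreadTie env _ :=
    .ifRel hf hm _ _ (.ifRel hf hm _ _ .skip (.ifRel hf hm _ _ (.ifRel hf hm _ _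
      (.ifEq hf _ _ .skip (.ifRel hf hm _ _ (.ifRel hf hm _ _ .skip h) .skip)) .skip) .skip)) .skip
  refine (h₁.seq h₂).congr fun i j => ?_
  simp only [and_false, or_false, false_or, Separates, ne_eq, or_and_right, and_assoc]

theorem spreads_round {f : Memory} (hf : f.bit = false) (w : List Γ') (env : Var → ℕ)
    (hm : env .m₁ = env .m + 1) : Spreads f w round env (Edge w (env .n) (env .m)) := by
  refine .forUpTo _ _ fun t _ => .forUpTo _ _ fun a _ => .forUpTo _ _ fun b _ =>
    .forUpTo _ _ fun c _ => .forUpTo _ _ fun e _ => ?_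
  exact spreads_body hf w _ (by simpa using hm)

end OutsideOptions

/-! ### Reachability, the checks, and the main program -/

namespace OutsideOptions

open Computability (Γ')

theorem index_lt {m n x y : ℕ} (hx : x < m) (hy : y < n) : x * n + y < m * n := by
  have := Nat.mul_le_mul_right n (Nat.succ_le_of_lt hx)
  rw [Nat.succ_mul] at this
  omega

theorem Edge.lt {w : List Γ'} {n m i j : ℕ} (h : Edge w n m i j) : j < m * m := by
  obtain ⟨t, -, a, ha, b, hb, c, hc, e, -, -, h⟩ := h
  rcases h with ⟨-, rfl⟩ | ⟨-, rfl⟩ | ⟨-, rfl⟩ | ⟨-, rfl⟩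
  · exact index_lt hb hc
  · exact index_lt ha hc
  · exact index_lt hc hb
  · exact index_lt hc ha

/-- Mark all pairs that can be reached from the pair `(s, s')`. -/
def closure : Program :=
  .seq (.forUpTo .k .q (.push .reach fun _ => .bit false)) <|
  .seq (addMul .s .m) <| .seq (addVar .s') <| .seq setReach (.forUpTo .r .q round)

theorem run_closure {f : Memory} (hf : f.bit = false) (w : List Γ') (env : Var → ℕ)
    (hm : env .m₁ = env .m + 1) (hq : env .q = env .m * env .m) (hs : env .s < env .m)
    (hs' : env .s' < env .m) :
    ∃ Y, closure.run env (f, regs w [] 0 [] []) = (f, regs w [] 0 [] Y) ∧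
      marked Y = {j | Relation.ReflTransGen (Edge w (env .n) (env .m))
        (env .s * env .m + env .s') j} := by
  have hround (i : ℕ) :=
    spreads_round hf w (Function.update env .r i) (by simpa using hm)
  choose g hg using hround
  -- The contents of `reach` after `n` rounds, starting from zeros with a single mark at the pair
  -- `(s, s')`. As there are `q = m * m` pairs, `q` rounds suffice.
  let S : ℕ → List Γ' := fun n => n.rec ((List.replicate (env .q) (Γ'.bit false)).modify
    (env .s * env .m + env .s') fun _ => .bit true) g
  have h₁ := run_forUpTo (.push .reach fun _ => .bit false) env .k .q
    (fun i => (f, regs w [] 0 [] (List.replicate i (.bit false)))) fun i _ => by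
      simp [LoopProgram.run, List.replicate_succ]
  have h₂ := run_forUpTo round env .r .q (fun i => (f, regs w [] 0 [] (S i)))
    fun i _ => (hg i (S i)).1
  refine ⟨S (env .q), ?_, ?_⟩
  · simp only [closure, LoopProgram.run.eq_5]
    rw [List.replicate_zero] at h₁
    rw [h₁, run_addMul _ _ _ _ _ _ _ _ _ (by simp),
      run_addVar, run_setReach, Nat.zero_add]
    exact h₂
  · rw [hq]
    refine Spread.marked_eq_of_iterate S _ _ (by simp [S, hq]) ?_ (fun i j h => h.lt)
      fun i => by simpa using (hg i (S i)).2
    ext j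
    have hlt := index_lt hs hs'
    change ((List.replicate (env .q) (Γ'.bit false)).modify (env .s * env .m + env .s')
      fun _ => .bit true)[j]? = some (.bit true) ↔ j = _
    rw [List.getElem?_modify, List.getElem?_replicate, hq]
    by_cases e : j = env .s * env .m + env .s'
    · simp [e, hlt]
    · by_cases h : j < env .m * env .m
      · simp [e, Ne.symm e, h]
      · simp [e, h]

/-- The program `p` replaces a bit `x` of the memory, which is otherwise described by `M`, by the
truth value of `x` and `P`. -/
def Checks (M : Bool → Memory) (w : List Γ') (p : Program) (env : Var → ℕ) (P : Prop) : Prop :=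
  ∀ x, ∃ y, p.run env (M x, regs w [] 0 [] []) = (M y, regs w [] 0 [] []) ∧
    (y = true ↔ x = true ∧ P)

namespace Checks

variable {M : Bool → Memory} {w : List Γ'} {p p' : Program} {env : Var → ℕ} {P P' : Prop}

theorem congr (h : Checks M w p env P) (hP : P ↔ P') : Checks M w p env P' := by
  rwa [← propext hP]

theorem skip : Checks M w skip env True := fun x => ⟨x, rfl, by simp⟩

theorem seq (h : Checks M w p env P) (h' : Checks M w p' env P') :
    Checks M w (.seq p p') env (P ∧ P') := by
  intro x
  obtain ⟨y, hy, hxy⟩ := h x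
  obtain ⟨z, hz, hyz⟩ := h' y
  exact ⟨z, by rw [LoopProgram.run.eq_5, hy, hz], by rw [hyz, hxy, and_assoc]⟩

theorem forUpTo (x v : Var) {P : ℕ → Prop}
    (h : ∀ i < env v, Checks M w p (Function.update env x i) (P i)) :
    Checks M w (.forUpTo x v p) env (∀ i < env v, P i) := by
  intro b
  have key : ∀ n ≤ env v, ∃ y, (List.range n).foldl
      (fun s i => p.run (Function.update env x i) s) (M b, regs w [] 0 [] []) =
        (M y, regs w [] 0 [] []) ∧ (y = true ↔ b = true ∧ ∀ i < n, P i) := by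
    intro n
    induction n with
    | zero => exact fun _ => ⟨b, rfl, by simp⟩
    | succ n ih =>
      intro hn
      obtain ⟨y, hy, hby⟩ := ih (by omega)
      obtain ⟨z, hz, hyz⟩ := h n hn y
      refine ⟨z, by rw [LoopProgram.run_forUpTo_succ, hy, hz], ?_⟩
      rw [hyz, hby, and_assoc, Nat.forall_lt_succ_right]
  exact key _ le_rfl

theorem ifEq (hM : ∀ x, (M x).bit = false) (v v' : Var) (h : Checks M w p env P)
    (h' : Checks M w p' env P') :
    Checks M w (ifEq v v' p p') env (if env v = env v' then P else P') := by
  intro x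
  rw [run_ifEq _ _ _ _ _ _ _ _ _ (hM x)]
  split_ifs
  · exact h x
  · exact h' x

theorem ifRel (hM : ∀ x, (M x).bit = false) (hm : env .m₁ = env .m + 1) (v v' : Var)
    (h : Checks M w p env P) (h' : Checks M w p' env P') :
    Checks M w (ifRel v v' p p') env
      (if RelAt w (env .m) (env .t) (env v) (env v') then P else P') := by
  intro x
  rw [run_ifRel _ hm _ _ _ _ _ _ _ _ _ (hM x)]
  split_ifs
  · exact h x
  · exact h' x

theorem ifVote (hM : ∀ x, (M x).bit = false) (hm : env .m₁ = env .m + 1)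
    (h : Checks M w p env P) (h' : Checks M w p' env P') :
    Checks M w (ifVote p p') env (if VoteAt w (env .m) (env .t) then P else P') := by
  intro x
  rw [run_ifVote _ hm _ _ _ _ _ _ _ (hM x)]
  split_ifs
  · exact h x
  · exact h' x

end Checks

/-- Check that `a` is better than `b` unless they are equal. -/
def checkBetter : Program :=
  ifEq .b .a skip <| ifRel .a .b (ifRel .b .a (.load fun f => { f with good := false }) skip)
    (.load fun f => { f with good := false })

/-- Check whether `a` is the most preferred candidate of the vote number `t`. -/
def checkCandidate : Program :=
  .seq (.load fun f => { f with good := true }) <| .seq (.forUpTo .b .m checkBetter)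
    (.load fun f => { f with found := f.found || f.good, good := false })

/-- Check that the vote number `t` has a unique most preferred candidate. -/
def checkVote : Program :=
  .seq (.forUpTo .a .m checkCandidate)
    (.load fun f => { f with ok := f.ok && f.found, found := false })

/-- Check that each vote has a unique most preferred candidate. -/
def checkVotes : Program := .forUpTo .t .n (ifVote checkVote skip)

/-- Check that the pair `(s, s')` is not linked to its reverse. -/
def checkPair : Program :=
  ifEq .s .s' skip <| .seq closure <| .seq (addMul .s' .m) <| .seq (addVar .s) <|
    .seq (test .reach (.bit true) (.load fun f => { f with ok := false }) skip) (.clear .reach)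

/-- Check that no pair of distinct candidates is linked to its reverse. -/
def checkPairs : Program := .forUpTo .s .m (.forUpTo .s' .m checkPair)

/-- In the vote number `t`, candidate `a` is better than all others. -/
def TopAt (w : List Γ') (m t a : ℕ) : Prop :=
  ∀ b < m, b = a ∨ (RelAt w m t a b ∧ ¬ RelAt w m t b a)

section checks

variable (w : List Γ') (env : Var → ℕ) (hm : env .m₁ = env .m + 1)

include hm

theorem checks_checkBetter (ok found : Bool) :
    Checks (fun x => ⟨false, ok, found, x⟩) w checkBetter env
      (env .b = env .a ∨ (RelAt w (env .m) (env .t) (env .a) (env .b) ∧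
        ¬ RelAt w (env .m) (env .t) (env .b) (env .a))) := by
  have bad : Checks (fun x => ⟨false, ok, found, x⟩) w
      (.load fun f => { f with good := false }) env False := fun x => ⟨false, rfl, by simp⟩
  have hM : ∀ x, (Memory.mk false ok found x).bit = false := fun _ => rfl
  refine (Checks.ifEq hM _ _ .skip
    (.ifRel hM hm _ _ (.ifRel hM hm _ _ bad .skip) bad)).congr ?_
  split_ifs <;> simp_all

/-- `Checks` accumulates conjunctions, whereas the search for a top candidate is a disjunction. It
is described by the negation of `found`: the bit `x` stays true as long as no top candidate has been
seen. -/
theorem checks_checkCandidate (ok : Bool) :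
    Checks (fun x => ⟨false, ok, !x, false⟩) w checkCandidate env
      (¬ TopAt w (env .m) (env .t) (env .a)) := by
  intro x
  obtain ⟨y, hy, hxy⟩ := Checks.forUpTo .b .m (fun i _ =>
    checks_checkBetter w (Function.update env .b i) (by simpa using hm) ok !x) true
  refine ⟨x && !y, ?_, ?_⟩
  · simp only [checkCandidate, LoopProgram.run.eq_5]
    rw [show (LoopProgram.load fun f : Memory => { f with good := true }).run env
      (⟨false, ok, !x, false⟩, regs w [] 0 [] []) = (⟨false, ok, !x, true⟩, regs w [] 0 [] [])
      from rfl, hy]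
    simp [LoopProgram.run]
  · have e : y = true ↔ TopAt w (env .m) (env .t) (env .a) := by simpa [TopAt] using hxy
    rw [← e]
    simp

theorem checks_checkVote :
    Checks (fun x => ⟨false, x, false, false⟩) w checkVote env
      (∃ a < env .m, TopAt w (env .m) (env .t) a) := by
  intro x
  obtain ⟨y, hy, hxy⟩ := Checks.forUpTo .a .m (fun i _ =>
    checks_checkCandidate w (Function.update env .a i) (by simpa using hm) x) true
  refine ⟨x && !y, ?_, ?_⟩
  · simp only [checkVote, LoopProgram.run.eq_5]
    rw [show Memory.mk false x false false = ⟨false, x, !true, false⟩ from rfl, hy]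
    simp [LoopProgram.run]
  · have e : y = true ↔ ¬ ∃ a < env .m, TopAt w (env .m) (env .t) a := by
      simpa using hxy
    rw [Bool.and_eq_true, Bool.not_eq_true', ← Bool.not_eq_true, e, not_not]

theorem checks_checkVotes :
    Checks (fun x => ⟨false, x, false, false⟩) w checkVotes env
      (∀ t < env .n, VoteAt w (env .m) t → ∃ a < env .m, TopAt w (env .m) t a) := by
  refine Checks.forUpTo .t .n fun t _ => ?_
  refine ((checks_checkVote w _ (by simpa using hm)).ifVote (fun _ => rfl) (by simpa using hm)
    .skip).congr ?_
  simp only [ne_eq, reduceCtorEq, not_false_eq_true, Function.update_of_ne, Function.update_self]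
  split_ifs with h <;> simp [h]

theorem checks_checkPair (hq : env .q = env .m * env .m) (hs : env .s < env .m)
    (hs' : env .s' < env .m) :
    Checks (fun x => ⟨false, x, false, false⟩) w checkPair env
      (env .s = env .s' ∨ ¬ Relation.ReflTransGen (Edge w (env .n) (env .m))
        (env .s * env .m + env .s') (env .s' * env .m + env .s)) := by
  have h : Checks (fun x => ⟨false, x, false, false⟩) w (.seq closure <| .seq (addMul .s' .m) <|
      .seq (addVar .s) <| .seq (test .reach (.bit true) (.load fun f => { f with ok := false }) skip)
        (.clear .reach)) env (¬ Relation.ReflTransGen (Edge w (env .n) (env .m))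
        (env .s * env .m + env .s') (env .s' * env .m + env .s)) := by
    intro x
    obtain ⟨Y, hY, hmarked⟩ :=
      run_closure (f := ⟨false, x, false, false⟩) rfl w env hm hq hs hs'
    have e := Set.ext_iff.1 hmarked (env .s' * env .m + env .s)
    simp only [marked, Set.mem_ofPred_eq] at e
    simp only [LoopProgram.run.eq_5]
    rw [hY, run_addMul _ _ _ _ _ _ _ _ _ (by simp), run_addVar,
      run_test _ _ _ _ _ _ _ _ _ _ _ rfl, Nat.zero_add, regs_reach]
    split_ifs with h
    · exact ⟨false, by simp [LoopProgram.run], by simp [← e, h]⟩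
    · exact ⟨x, by simp [LoopProgram.run], by simp [← e, h]⟩
  refine (Checks.ifEq (fun _ => rfl) _ _ .skip h).congr ?_
  split_ifs with h <;> simp [h]

theorem checks_checkPairs (hq : env .q = env .m * env .m) :
    Checks (fun x => ⟨false, x, false, false⟩) w checkPairs env
      (∀ s < env .m, ∀ s' < env .m, s = s' ∨
        ¬ Relation.ReflTransGen (Edge w (env .n) (env .m))
          (s * env .m + s') (s' * env .m + s)) := by
  refine Checks.forUpTo .s .m fun s hs => ?_
  refine (Checks.forUpTo .s' .m fun s' hs' => checks_checkPair w _ (by simpa using hm)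
    (by simpa using hq) (by simpa using hs) (by simpa using hs')).congr ?_
  simp

end checks

/-- Count the leading symbols `1` of the input in the register `size`. -/
def scan : Program :=
  .seq (.forUpTo .k .n <| .seq (.access .input .index
      (fun f o => { f with found := f.found || !decide (o = some (.bit true)) }) fun _ d => d) <|
    .seq (.ite Memory.found skip (.push .size fun _ => .bit true)) tick) <|
  .seq (.clear .index) (.load fun f => { f with found := false })

/-- The flag `found` is set on reading the comma at position `m` and stays set, so that later
symbols `1`, which belong to votes, are not counted. -/
theorem run_scan (m : ℕ) (l : List Γ') (env : Var → ℕ)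
    (hn : env .n = (List.replicate m (Γ'.bit true) ++ .comma :: l).length) :
    scan.run env (⟨false, true, false, false⟩,
      regs (List.replicate m (.bit true) ++ .comma :: l) [] 0 [] []) =
      (⟨false, true, false, false⟩, regs (List.replicate m (.bit true) ++ .comma :: l)
        (List.replicate m (.bit true)) 0 [] []) := by
  set w := List.replicate m (Γ'.bit true) ++ .comma :: l with hw
  have h := run_forUpTo (.seq (.access .input .index
      (fun f o => { f with found := f.found || !decide (o = some (.bit true)) }) fun _ d => d) <|
    .seq (.ite Memory.found skip (.push .size fun _ => .bit true)) tick) env .k .n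
    (fun i => (⟨false, true, decide (m < i), false⟩,
      regs w (List.replicate (min i m) (.bit true)) i [] [])) fun i _ => by
    simp only [LoopProgram.run, regs_input, regs_index, List.length_replicate, modify_self,
      update_input]
    rcases lt_trichotomy i m with h | h | h
    · have e : w[i]? = some (.bit true) := by
        rw [hw, List.getElem?_append_left (by simpa using h)]
        simp [h]
      have h₁ : ¬ m < i := by omega
      have h₂ : ¬ m < i + 1 := by omega
      rw [Nat.min_eq_left h.le, Nat.min_eq_left (Nat.succ_le_of_lt h)]
      simp [e, h₁, h₂, List.replicate_succ]
    · have e : w[i]? = some .comma := by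
        rw [hw, List.getElem?_append_right (by simp [h]), h]
        simp
      rw [h] at e ⊢
      simp [e]
    · have h₁ : m < i + 1 := by omega
      rw [Nat.min_eq_right h.le, Nat.min_eq_right h₁.le]
      simp [h, h₁]
  have hmn : m < env .n := by rw [hn, hw]; simp
  simp only [Nat.zero_min, List.replicate_zero, Nat.not_lt_zero, decide_false,
    Nat.min_eq_right hmn.le, hmn, decide_true] at h
  simp only [scan, LoopProgram.run.eq_5]
  rw [h]
  simp [LoopProgram.run]

/-- The decision program. -/
def main : Program :=
  .letLength .n .input <| .seq scan <| .letLength .m .size <|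
  .seq (.push .size fun _ => .bit true) <| .letLength .m₁ .size <| .seq (.clear .size) <|
  .seq (addMul .m .m) <| .letLength .q .index <| .seq (.clear .index) <|
  .seq checkVotes <| .seq checkPairs (.clear .input)

theorem run_main (m : ℕ) (l w : List Γ') (hw : w = List.replicate m (.bit true) ++ .comma :: l) :
    ∃ f, main.run (fun _ => 0) (⟨false, true, false, false⟩,
        Function.update (fun _ => []) .input w) = (f, fun _ => []) ∧
      (f.ok = true ↔ (∀ t < w.length, VoteAt w m t → ∃ a < m, TopAt w m t a) ∧
        ∀ s < m, ∀ s' < m, s = s' ∨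
          ¬ Relation.ReflTransGen (Edge w w.length m) (s * m + s') (s' * m + s)) := by
  let env₁ : Var → ℕ := Function.update (fun _ => 0) .n w.length
  let env₂ := Function.update env₁ .m m
  let env₃ := Function.update env₂ .m₁ (m + 1)
  let env₄ := Function.update env₃ .q (m * m)
  -- In `env₄` the variables have the values computed by the nested `letLength`: the length of the
  -- input as a bound for the number of votes, then `m`, `m + 1` and `m * m`.
  have hc := (checks_checkVotes w env₄ rfl).seq (checks_checkPairs w env₄ rfl rfl)
  obtain ⟨y, hy, hP⟩ := hc true
  refine ⟨⟨false, y, false, false⟩, ?_, ?_⟩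
  · have h₁ := run_scan m l env₁ (by simp [env₁, hw])
    rw [← hw] at h₁
    have e₀ : Function.update (fun _ => []) Reg.input w = regs w [] 0 [] [] := by
      funext r; cases r <;> rfl
    have e₁ : (fun _ => []) = regs [] [] 0 [] [] := by
      funext r; cases r <;> rfl
    rw [e₀, e₁]
    rw [LoopProgram.run.eq_5] at hy
    simp only [main, LoopProgram.run.eq_5, LoopProgram.run.eq_8, regs_input]
    change _ = _ at h₁
    rw [show Function.update (fun _ => 0) Var.n w.length = env₁ from rfl, h₁]
    simp only [regs_size, List.length_replicate]
    rw [show Function.update env₁ Var.m m = env₂ from rfl]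
    simp only [LoopProgram.run.eq_2, regs_size, update_size, List.length_cons,
      List.length_replicate]
    rw [show Function.update env₂ Var.m₁ (m + 1) = env₃ from rfl]
    simp only [LoopProgram.run.eq_3, update_size]
    rw [run_addMul _ _ _ _ _ _ _ _ _ (by simp)]
    simp only [regs_index, List.length_replicate, Nat.zero_add]
    rw [show Function.update env₃ Var.q (env₃ .m * env₃ .m) = env₄ from rfl, update_index_nil, hy,
      update_input]
  · simpa [env₄, env₃, env₂, env₁] using hP

end OutsideOptions

/-! ### Correctness of the program on encoded profiles -/

namespace List

variable {α β : Type*}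

theorem getElem?_flatMap_of_length_eq {f : α → List β} {n : ℕ} (hf : ∀ a, (f a).length = n)
    (l : List α) (i : ℕ) {j : ℕ} (hj : j < n) :
    (l.flatMap f)[i * n + j]? = l[i]?.bind fun a => (f a)[j]? := by
  induction l generalizing i with
  | nil => simp
  | cons a l ih =>
    rw [flatMap_cons]
    cases i with
    | zero => rw [getElem?_append_left (by rw [hf]; omega)]; simp
    | succ i =>
      have e : (i + 1) * n + j = n + (i * n + j) := by ring
      rw [e, getElem?_append_right (by rw [hf]; omega), hf, Nat.add_sub_cancel_left, ih]
      simp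

end List

theorem WeakOrder.getElem?_encode_zero {m : ℕ} (v : WeakOrder (Fin m)) :
    v.encode[0]? = some .bra := rfl

theorem WeakOrder.getElem?_encode_rel {m : ℕ} (v : WeakOrder (Fin m)) (a b : Fin m) :
    v.encode[1 + (a * (m + 1) + b)]? = some (.bit true) ↔ v.rel a b := by
  have hlt := OutsideOptions.index_lt a.2 (b.2.trans (Nat.lt_add_one m))
  rw [encode, List.append_assoc, List.getElem?_append_right (by simp), List.length_singleton,
    Nat.add_sub_cancel_left, List.ofFn_eq_map, ← List.flatMap_def, List.getElem?_append_left,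
    List.getElem?_flatMap_of_length_eq (n := m + 1) (by simp) _ _ (by omega)]
  · simp
  · simpa [List.length_flatMap] using hlt

theorem Profile.getElem?_encode (V : Profile) (t : ℕ) {j : ℕ}
    (hj : j < V.numCandidates * (V.numCandidates + 1) + 2) :
    V.encode[V.numCandidates + 1 +
        (t * (V.numCandidates * (V.numCandidates + 1) + 2) + j)]? =
      V.votes[t]?.bind fun v => v.encode[j]? := by
  rw [encode, List.getElem?_append_right (by simp), List.length_append, List.length_replicate,
    List.length_singleton, Nat.add_sub_cancel_left,
    List.getElem?_flatMap_of_length_eq WeakOrder.length_encode _ _ hj]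

/-- In the first case the upper set of the worse of `a` and `b` separates them from `c`; in the
second, `a` together with all candidates better than `a`. -/
theorem WeakOrder.exists_mem_intervals {C : Type} {v : WeakOrder C} {a b c e : C}
    (h : (v.Prefers a c ∧ v.Prefers b c) ∨
      (v.Prefers b a ∧ v.rel c a ∧ v.rel a c ∧ c ≠ a ∧ v.Prefers a e)) :
    ∃ S ∈ v.intervals, a ∈ S ∧ b ∈ S ∧ c ∉ S := by
  rcases h with ⟨hac, hbc⟩ | ⟨hba, hca, hac, hne, hae⟩
  · rcases v.complete a b with h | h
    · exact ⟨{x | v.rel x b}, ⟨b, .inl rfl⟩, h, v.refl b, hbc.2⟩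
    · exact ⟨{x | v.rel x a}, ⟨a, .inl rfl⟩, v.refl a, h, hac.2⟩
  · refine ⟨{x | v.Prefers x a ∨ x = a}, ⟨a, .inr ⟨⟨e, hae⟩, rfl⟩⟩, .inr rfl, .inl hba, ?_⟩
    rintro (h | h)
    · exact h.2 hac
    · exact hne h

/-- If the threshold `d` is strictly better than `c`, so are `a` and `b`. Otherwise `S` is of the
second kind and `c` is tied with `d`: members other than `d` are still better than `c`, so the
remaining cases have `a = d` or `b = d`. -/
theorem WeakOrder.eq_or_of_mem_intervals {C : Type} {v : WeakOrder C} {S : Set C}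
    (hS : S ∈ v.intervals) {a b c : C} (ha : a ∈ S) (hb : b ∈ S) (hc : c ∉ S) :
    a = b ∨ (v.Prefers a c ∧ v.Prefers b c) ∨ ∃ e,
      (v.Prefers b a ∧ v.rel c a ∧ v.rel a c ∧ c ≠ a ∧ v.Prefers a e) ∨
      (v.Prefers a b ∧ v.rel c b ∧ v.rel b c ∧ c ≠ b ∧ v.Prefers b e) := by
  obtain ⟨d, rfl | ⟨⟨e, he⟩, rfl⟩⟩ := hS
  · exact .inr (.inl ⟨WeakOrder.Prefers.rel_trans ha (not_rel.1 hc),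
      WeakOrder.Prefers.rel_trans hb (not_rel.1 hc)⟩)
  · simp only [Set.mem_ofPred_eq, not_or] at ha hb hc
    have hdc : v.rel d c := by
      by_contra h
      exact hc.1 (not_rel.1 h)
    by_cases hcd : v.rel c d
    · rcases ha with ha | rfl <;> rcases hb with hb | rfl
      · exact .inr (.inl ⟨ha.trans_rel hdc, hb.trans_rel hdc⟩)
      · exact .inr (.inr ⟨e, .inr ⟨ha, hcd, hdc, hc.2, he⟩⟩)
      · exact .inr (.inr ⟨e, .inl ⟨hb, hcd, hdc, hc.2, he⟩⟩)
      · exact .inl rfl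
    · have hdc' : v.Prefers d c := ⟨hdc, hcd⟩
      refine .inr (.inl ⟨?_, ?_⟩)
      · rcases ha with ha | rfl
        · exact ha.trans_rel hdc
        · exact hdc'
      · rcases hb with hb | rfl
        · exact hb.trans_rel hdc
        · exact hdc'

namespace OutsideOptions

open Computability (Γ')

section encoding

variable (V : Profile)

theorem voteAt_encode (t : ℕ) :
    VoteAt V.encode V.numCandidates t ↔ ∃ v, V.votes[t]? = some v := by
  rw [VoteAt, ← Nat.add_zero (t * _), V.getElem?_encode t (by omega)]
  cases V.votes[t]? <;> simp [WeakOrder.getElem?_encode_zero]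

theorem relAt_encode (t : ℕ) (a b : Fin V.numCandidates) :
    RelAt V.encode V.numCandidates t a b ↔ ∃ v, V.votes[t]? = some v ∧ v.rel a b := by
  have hlt : 1 + (a * (V.numCandidates + 1) + b) <
      V.numCandidates * (V.numCandidates + 1) + 2 := by
    have := index_lt a.2 (b.2.trans (Nat.lt_add_one _))
    omega
  rw [RelAt, Nat.add_assoc, Nat.add_assoc, Nat.add_assoc, V.getElem?_encode t hlt]
  cases V.votes[t]? <;> simp [WeakOrder.getElem?_encode_rel]

/-- The number of votes is not computed by the program. It is enough to let `t` run up to the length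
of the input, since each vote takes up space; for a nonexistent vote `RelAt` fails throughout, so
that no edges arise. -/
theorem lt_length_of_getElem? {t : ℕ} {v : WeakOrder (Fin V.numCandidates)}
    (h : V.votes[t]? = some v) : t < V.encode.length := by
  have h' := (voteAt_encode V t).2 ⟨v, h⟩
  obtain ⟨hlt, -⟩ := List.getElem?_eq_some_iff.1 h'
  have : t * 1 ≤ t * (V.numCandidates * (V.numCandidates + 1) + 2) :=
    Nat.mul_le_mul_left _ (by omega)
  omega

theorem topAt_encode {t : ℕ} {v : WeakOrder (Fin V.numCandidates)} (h : V.votes[t]? = some v)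
    (a : Fin V.numCandidates) : TopAt V.encode V.numCandidates t a ↔ v.IsTop a := by
  constructor
  · intro ht b hb
    have := (ht b b.2).resolve_left fun e => hb (Fin.ext e)
    simpa [relAt_encode, h, WeakOrder.Prefers] using this
  · intro ht b hb
    by_cases e : b = a
    · exact .inl e
    · have := ht ⟨b, hb⟩ fun h => e (by rw [← h])
      have h₁ := relAt_encode V t a ⟨b, hb⟩
      have h₂ := relAt_encode V t ⟨b, hb⟩ a
      simp only [h, Option.some.injEq, exists_eq_left'] at h₁ h₂
      exact .inr ⟨h₁.2 this.1, fun h => this.2 (h₂.1 h)⟩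

theorem separates_encode (t : ℕ) (e a b c : Fin V.numCandidates) :
    Separates V.encode V.numCandidates t e a b c ↔ ∃ v, V.votes[t]? = some v ∧
      ((v.Prefers a c ∧ v.Prefers b c) ∨
        (v.Prefers b a ∧ v.rel c a ∧ v.rel a c ∧ c ≠ a ∧ v.Prefers a e)) := by
  simp only [Separates, relAt_encode, ne_eq, Fin.val_inj]
  cases V.votes[t]? <;> simp [WeakOrder.Prefers, and_assoc]

theorem exists_top_iff :
    (∀ t < V.encode.length, VoteAt V.encode V.numCandidates t →
      ∃ a < V.numCandidates, TopAt V.encode V.numCandidates t a) ↔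
      ∀ v ∈ V.votes, ∃ p, v.IsTop p := by
  constructor
  · intro h v hv
    obtain ⟨t, ht⟩ := List.getElem?_of_mem hv
    obtain ⟨a, ha, h'⟩ := h t (lt_length_of_getElem? V ht) ((voteAt_encode V t).2 ⟨v, ht⟩)
    exact ⟨⟨a, ha⟩, (topAt_encode V ht ⟨a, ha⟩).1 h'⟩
  · intro h t _ ht
    obtain ⟨v, hv⟩ := (voteAt_encode V t).1 ht
    obtain ⟨p, hp⟩ := h v (List.mem_of_getElem? hv)
    exact ⟨p, p.2, (topAt_encode V hv p).2 hp⟩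

/-- The number that represents a pair of candidates. -/
def index {m : ℕ} (q : Fin m × Fin m) : ℕ := q.1 * m + q.2

theorem index_injective {m : ℕ} : Function.Injective (index (m := m)) := by
  rintro ⟨a, b⟩ ⟨c, d⟩ h
  have hm : 0 < m := a.pos
  have h₁ := congrArg (· / m) h
  have h₂ := congrArg (· % m) h
  simp only [index, Nat.mul_comm _ m, Nat.mul_add_div hm, Nat.mul_add_mod,  Nat.div_eq_of_lt b.2, Nat.div_eq_of_lt d.2, Nat.mod_eq_of_lt b.2, Nat.mod_eq_of_lt d.2,
    Nat.add_zero] at h₁ h₂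
  exact Prod.ext (Fin.ext h₁) (Fin.ext h₂)

theorem Edge.exists_forcingStep {q : Fin V.numCandidates × Fin V.numCandidates} {j : ℕ}
    (h : Edge V.encode V.encode.length V.numCandidates (index q) j) :
    ∃ r, j = index r ∧ ForcingStep V.intervals q r := by
  obtain ⟨t, -, a, ha, b, hb, c, hc, e, he, hsep, hedge⟩ := h
  lift a to Fin V.numCandidates using ha
  lift b to Fin V.numCandidates using hb
  lift c to Fin V.numCandidates using hc
  lift e to Fin V.numCandidates using he
  obtain ⟨v, hv, h⟩ := (separates_encode V t e a b c).1 hsep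
  obtain ⟨S, hS, haS, hbS, hcS⟩ := WeakOrder.exists_mem_intervals h
  have hSV : S ∈ V.intervals := ⟨v, List.mem_of_getElem? hv, hS⟩
  rcases hedge with ⟨hi, rfl⟩ | ⟨hi, rfl⟩ | ⟨hi, rfl⟩ | ⟨hi, rfl⟩
  · obtain rfl : q = (a, c) := index_injective hi
    exact ⟨(b, c), rfl, forcingStep_left hSV haS hbS hcS⟩
  · obtain rfl : q = (b, c) := index_injective hi
    exact ⟨(a, c), rfl, forcingStep_left hSV hbS haS hcS⟩
  · obtain rfl : q = (c, a) := index_injective hi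
    exact ⟨(c, b), rfl, forcingStep_right hSV haS hbS hcS⟩
  · obtain rfl : q = (c, b) := index_injective hi
    exact ⟨(c, a), rfl, forcingStep_right hSV hbS haS hcS⟩

/-- A forcing step may have `a = b`, which need not give an edge but does not move the pair.
Otherwise the tie case may occur with `a` and `b` exchanged, which is covered because `PairEdge`
contains both directions. -/
theorem _root_.ForcingStep.edge {q r : Fin V.numCandidates × Fin V.numCandidates}
    (h : ForcingStep V.intervals q r) :
    q = r ∨ Edge V.encode V.encode.length V.numCandidates (index q) (index r) := by
  obtain ⟨S, ⟨v, hv, hS⟩, a, ha, b, hb, c, hc, h⟩ := h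
  obtain ⟨t, ht⟩ := List.getElem?_of_mem hv
  have hlt := lt_length_of_getElem? V ht
  have edge (a b e : Fin V.numCandidates)
      (h : (v.Prefers a c ∧ v.Prefers b c) ∨
        (v.Prefers b a ∧ v.rel c a ∧ v.rel a c ∧ c ≠ a ∧ v.Prefers a e)) {i j : ℕ}
      (hij : PairEdge V.numCandidates a b c i j) :
      Edge V.encode V.encode.length V.numCandidates i j :=
    ⟨t, hlt, a, a.2, b, b.2, c, c.2, e, e.2, (separates_encode V t e a b c).2 ⟨v, ht, h⟩, hij⟩
  have hab : PairEdge V.numCandidates a b c (index q) (index r) := by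
    rcases h with ⟨rfl, rfl⟩ | ⟨rfl, rfl⟩
    · exact .inl ⟨rfl, rfl⟩
    · exact .inr (.inr (.inl ⟨rfl, rfl⟩))
  have hba : PairEdge V.numCandidates b a c (index q) (index r) := by
    rcases h with ⟨rfl, rfl⟩ | ⟨rfl, rfl⟩
    · exact .inr (.inl ⟨rfl, rfl⟩)
    · exact .inr (.inr (.inr ⟨rfl, rfl⟩))
  rcases WeakOrder.eq_or_of_mem_intervals hS ha hb hc with rfl | h' | ⟨e, h' | h'⟩
  · left
    rcases h with ⟨rfl, rfl⟩ | ⟨rfl, rfl⟩ <;> rfl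
  -- This alternative does not involve `e`, and `a` merely fills its place.
  · exact .inr (edge a b a (.inl h') hab)
  · exact .inr (edge a b e (.inr h') hab)
  · exact .inr (edge b a e (.inr h') hba)

theorem reflTransGen_edge_iff (q r : Fin V.numCandidates × Fin V.numCandidates) :
    Relation.ReflTransGen (Edge V.encode V.encode.length V.numCandidates) (index q) (index r) ↔
      Linked V.intervals q r := by
  constructor
  · intro h
    have key : ∀ j, Relation.ReflTransGen (Edge V.encode V.encode.length V.numCandidates)
        (index q) j → ∃ r, j = index r ∧ Linked V.intervals q r := by
      intro j h
      induction h with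
      | refl => exact ⟨q, rfl, .refl⟩
      | tail _ h ih =>
        obtain ⟨r, rfl, hr⟩ := ih
        obtain ⟨r', rfl, hr'⟩ := Edge.exists_forcingStep V h
        exact ⟨r', rfl, hr.tail hr'⟩
    obtain ⟨r', e, hr'⟩ := key _ h
    rwa [index_injective e]
  · intro h
    induction h with
    | refl => exact .refl
    | tail _ h ih =>
      rcases ForcingStep.edge V h with rfl | h
      · exact ih
      · exact ih.tail h

end encoding

theorem wellFormed_main : main.WellFormed [] := by
  simp [LoopProgram.WellFormed, LoopProgram.LetFree, main, scan, checkVotes, checkVote,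
    checkCandidate, checkBetter, checkPairs, checkPair, closure, round, spreadLower, spreadTie,
    spread, propagate, setReach, ifRel, ifVote, ifEq, addVote, test, addMul, addVar, tick,
    resetBit, skip]

end OutsideOptions

open OutsideOptions in
theorem mainTheorem5 :
    DecidableInPolyTime Profile.encode
      (fun V => ∃ L : Axis (Fin V.numCandidates), V.IsSinglePeakedWithOutsideOptions L) := by
  refine LoopProgram.decidableInPolyTime _ _ main wellFormed_main .input
    ⟨false, true, false, false⟩ Memory.ok fun V => ?_
  obtain ⟨f, hf, hok⟩ := run_main V.numCandidates (V.votes.flatMap WeakOrder.encode) V.encode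
    (by simp [Profile.encode])
  refine ⟨f, hf, ?_⟩
  rw [hok, V.exists_axis_iff, exists_top_iff]
  refine and_congr_right fun _ => ⟨fun h q hq => ?_, fun h s hs s' hs' => ?_⟩
  · rw [← reflTransGen_edge_iff]
    exact (h q.1 q.1.2 q.2 q.2.2).resolve_left fun e => hq (Fin.ext e)
  · refine or_iff_not_imp_left.2 fun e => ?_
    have := h (⟨s, hs⟩, ⟨s', hs'⟩) fun h => e (congrArg Fin.val h)
    rwa [← reflTransGen_edge_iff] at this
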